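/- **Theorem (Shuffle identity).** Let $V$ be a finite-dimensional real normed space with algebraic dual $V^*$, let $a\le b$ be real numbers and $p\in[1,2)$, and let $x\in C_p([a,b],V)$, i.e. $x:[a,b]\to V$ is continuous with finite $p$-variation $$\|x\|_{p,[a,b]}=\Big(\sup_{a=u_0\le\dots\le u_n=b}\ \sum_{i<n}\|x_{u_{i+1}}-x_{u_i}\|^p\Big)^{1/p}<\infty .$$ For $t\in[a,b]$ let $S(x)^{(0)}_{[a,t]}=1\in V^{\otimes 0}=\mathbb R$ and, for $k\ge 0$, $$S(x)^{(k+1)}_{[a,t]}=\int_a^t S(x)^{(k)}_{[a,u]}\otimes dx_u=\int_{a<t_1<\dots<t_{k+1}<t}dx_{t_1}\otimes\cdots\otimes dx_{t_{k+1}}\in V^{\otimes (k+1)},$$ where the integral is a Young integral: the limit, as the mesh of the partition of $[a,t]$ tends to zero, of the Riemann–Stieltjes sums $\sum_i S(x)^{(k)}_{[a,\xi_i]}\otimes(x_{u_{i+1}}-x_{u_i})$ with arbitrary tags $\xi_i\in[u_i,u_{i+1}]$. Let $S(x)_{[a,b]}=\big(S(x)^{(k)}_{[a,b]}\big)_{k\ge0}\in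 T((V))=\prod_{k\ge0}V^{\otimes k}$ be the signature of $x$. The pairing of $f=\sum_k f_k\in T(V^*)=\bigoplus_{k\ge0}(V^*)^{\otimes k}$ with $s=(s_k)_k\in T((V))$ is $\langle f,s\rangle=\sum_k f_k(s_k)$, where $(\varphi_1\otimes\cdots\otimes\varphi_k)(v_1\otimes\cdots\otimes v_k)=\prod_i\varphi_i(v_i)$. The shuffle product $\mathbin{\sqcup\!\sqcup}$ on $T(V^*)$ is the bilinear product such that $f \mathbin{\sqcup\!\sqcup} r=r \mathbin{\sqcup\!\sqcup} f=rf$ for $r\in\mathbb R=(V^*)^{\otimes 0}$ and $f\in T(V^*)$, and $$(f\cdot\alpha) \mathbin{\sqcup\!\sqcup} (g\cdot\beta)=\big(f \mathbin{\sqcup\!\sqcup} (g\cdot\beta)\big)\cdot\alpha+\big((f\cdot\alpha) \mathbin{\sqcup\!\sqcup} g\big)\cdot\beta$$ for $f\in(V^*)^{\otimes k}$, $g\in(V^*)^{\otimes l}$ and $\alpha,\beta\in V^*$, where $\cdot$ is the tensor product. Then all the Young integrals above (every $k\ge 0$ and $t\in[a,b]$) exist, and for all $f,g\in T(V^*)$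 $$\langle f,S(x)_{[a,b]}\rangle\,\langle g,S(x)_{[a,b]}\rangle=\langle f \mathbin{\sqcup\!\sqcup} g,\,S(x)_{[a,b]}\rangle .$$ -/

import Mathlib

open scoped TensorProduct DirectSum ENNReal

noncomputable section

namespace Sig

/-! ### Tensor powers, the tensor algebra and formal tensor series -/

section Algebra

variable (M : Type*) [AddCommGroup M] [Module ℝ M]

/-- The tensor algebra `T(M) = ⨁ₖ M^{⊗k}`; its product is the tensor product. -/
abbrev TAlg : Type _ := ⨁ k : ℕ, ⨂[ℝ]^k M

/-- The underlying space `∏ₖ M^{⊗k}` of the formal tensor series `T((M))`. -/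
abbrev TSeries : Type _ := ∀ k : ℕ, ⨂[ℝ]^k M

/-- The canonical isomorphism `M^{⊗k} ⊗ M ≃ M^{⊗(k+1)}`. -/
def snocEquiv (k : ℕ) : (⨂[ℝ]^k M) ⊗[ℝ] M ≃ₗ[ℝ] ⨂[ℝ]^(k + 1) M :=
  (TensorProduct.congr (LinearEquiv.refl ℝ (⨂[ℝ]^k M))
    (PiTensorProduct.subsingletonEquiv (R := ℝ) (s := fun _ => M) (0 : Fin 1)).symm).trans
    (TensorPower.mulEquiv (R := ℝ) (M := M) (n := k) (m := 1))

/-- The bilinear map `(w, v) ↦ w ⊗ v` from `M^{⊗k} × M` to `M^{⊗(k+1)}`. -/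
def snoc (k : ℕ) : (⨂[ℝ]^k M) →ₗ[ℝ] M →ₗ[ℝ] ⨂[ℝ]^(k + 1) M :=
  TensorProduct.curry (snocEquiv M k).toLinearMap

/-- The inclusion of `M^{⊗k}` into `T(M)`. -/
abbrev incl (k : ℕ) : (⨂[ℝ]^k M) →ₗ[ℝ] TAlg M :=
  DirectSum.lof ℝ ℕ (fun k => ⨂[ℝ]^k M) k

/-- The inclusion of `M = M^{⊗1}` into `T(M)`. -/
def inclVec : M →ₗ[ℝ] TAlg M :=
  incl M 1 ∘ₗ (PiTensorProduct.subsingletonEquiv (R := ℝ) (s := fun _ => M) (0 : Fin 1)).symm.toLinearMap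

variable {M}

/-- Given a bilinear map `B` on `M^{⊗k} × Y` with values in `T(M)`, the bilinear map on
`M^{⊗(k+1)} × Y` determined by `(w · a, y) ↦ B(w, y) · a` for `a ∈ M`. -/
def extendRight {Y : Type*} [AddCommGroup Y] [Module ℝ Y] (k : ℕ)
    (B : (⨂[ℝ]^k M) →ₗ[ℝ] Y →ₗ[ℝ] TAlg M) :
    (⨂[ℝ]^(k + 1) M) →ₗ[ℝ] Y →ₗ[ℝ] TAlg M :=
  TensorProduct.lift
    (((LinearMap.llcomp ℝ Y (TAlg M) (TAlg M)) ∘ₗ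
      ((LinearMap.mul ℝ (TAlg M)).flip ∘ₗ inclVec M)).flip ∘ₗ B) ∘ₗ
    (snocEquiv M k).symm.toLinearMap

theorem extendRight_snoc {Y : Type*} [AddCommGroup Y] [Module ℝ Y] (k : ℕ)
    (B : (⨂[ℝ]^k M) →ₗ[ℝ] Y →ₗ[ℝ] TAlg M) (w : ⨂[ℝ]^k M) (a : M) (y : Y) :
    extendRight k B (snoc M k w a) y = B w y * inclVec M a := by
  simp [extendRight, snoc]

variable (M)

/-- The shuffle product on homogeneous tensors: multiplication by scalars when one of the
degrees is zero and otherwise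
`(f · a) ⧢ (g · b) = (f ⧢ (g · b)) · a + ((f · a) ⧢ g) · b`. -/
def shuffleHom : ∀ k l : ℕ, (⨂[ℝ]^k M) →ₗ[ℝ] (⨂[ℝ]^l M) →ₗ[ℝ] TAlg M
  | 0, l => (LinearMap.lsmul ℝ (⨂[ℝ]^l M →ₗ[ℝ] TAlg M)).flip (incl M l) ∘ₗ
      (TensorPower.algebraMap₀ (R := ℝ) (M := M)).symm.toLinearMap
  | k + 1, 0 => ((LinearMap.lsmul ℝ (⨂[ℝ]^(k + 1) M →ₗ[ℝ] TAlg M)).flip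
      (incl M (k + 1)) ∘ₗ (TensorPower.algebraMap₀ (R := ℝ) (M := M)).symm.toLinearMap).flip
  | k + 1, l + 1 =>
      extendRight k (shuffleHom k (l + 1)) +
        (extendRight l (shuffleHom (k + 1) l).flip).flip
  termination_by k l => k + l

theorem shuffleHom_zero_left (l : ℕ) (r : ℝ) (g : ⨂[ℝ]^l M) :
    shuffleHom M 0 l (TensorPower.algebraMap₀ r) g = r • incl M l g := by
  rw [shuffleHom]; simp

theorem shuffleHom_zero_right (k : ℕ) (f : ⨂[ℝ]^k M) (r : ℝ) :
    shuffleHom M k 0 f (TensorPower.algebraMap₀ r) = r • incl M k f := by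
  cases k with
  | zero =>
    obtain ⟨c, rfl⟩ := (TensorPower.algebraMap₀ (R := ℝ) (M := M)).surjective f
    have h : ∀ q : ℝ, (TensorPower.algebraMap₀ q : ⨂[ℝ]^0 M)
        = q • TensorPower.algebraMap₀ (1 : ℝ) := fun q => by
      rw [← map_smul, smul_eq_mul, mul_one]
    rw [shuffleHom_zero_left, h r, h c, map_smul, map_smul, smul_comm]
  | succ k => rw [shuffleHom]; simp

theorem shuffleHom_snoc_snoc (k l : ℕ) (f : ⨂[ℝ]^k M) (a : M) (g : ⨂[ℝ]^l M) (b : M) :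
    shuffleHom M (k + 1) (l + 1) (snoc M k f a) (snoc M l g b) =
      shuffleHom M k (l + 1) f (snoc M l g b) * inclVec M a +
        shuffleHom M (k + 1) l (snoc M k f a) g * inclVec M b := by
  rw [shuffleHom]
  simp only [LinearMap.add_apply, LinearMap.flip_apply, extendRight_snoc]

/-- The shuffle product on `T(M)`, the bilinear extension of `shuffleHom`. -/
def shuffle : TAlg M →ₗ[ℝ] TAlg M →ₗ[ℝ] TAlg M :=
  DirectSum.toModule ℝ ℕ (TAlg M →ₗ[ℝ] TAlg M) fun k =>
    (DirectSum.toModule ℝ ℕ ((⨂[ℝ]^k M) →ₗ[ℝ] TAlg M) fun l => (shuffleHom M k l).flip).flip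

/-- The pairing of `T(M*)` with `T((M))`: `(f, s) ↦ ∑ₖ fₖ(sₖ)`, where `(M*)^{⊗k}` acts on
`M^{⊗k}` by `(φ₁ ⊗ ⋯ ⊗ φₖ)(v₁ ⊗ ⋯ ⊗ vₖ) = ∏ᵢ φᵢ(vᵢ)`. -/
def pairing (f : TAlg (Module.Dual ℝ M)) (s : TSeries M) : ℝ :=
  DirectSum.toModule ℝ ℕ ℝ (fun k => (TensorPower.pairingDual ℝ M k).flip (s k)) f

end Algebra

/-! ### Paths of finite `p`-variation, Young integrals and the signature -/

/-- `s = u 0 ≤ u 1 ≤ ⋯ ≤ u n = t`. Repeated points are harmless: they contribute nothing to the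
sums below. -/
def IsPartition (s t : ℝ) (n : ℕ) (u : ℕ → ℝ) : Prop :=
  u 0 = s ∧ u n = t ∧ ∀ i < n, u i ≤ u (i + 1)

section Paths

variable {V : Type*} [NormedAddCommGroup V] [NormedSpace ℝ V]

/-- The `p`-variation of `x` on `[s, t]`. -/
def pVariation (p : ℝ) (x : ℝ → V) (s t : ℝ) : ℝ≥0∞ :=
  (⨆ (n : ℕ) (u : ℕ → ℝ) (_ : IsPartition s t n u),
    ∑ i ∈ Finset.range n, ‖x (u (i + 1)) - x (u i)‖ₑ ^ p) ^ (1 / p)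

/-- `x ∈ C_p([a, b], V)`: continuous of finite `p`-variation on `[a, b]`. -/
def MemCp (p : ℝ) (a b : ℝ) (x : ℝ → V) : Prop :=
  ContinuousOn x (Set.Icc a b) ∧ pVariation p x a b < ∞

/-- `∫_s^t y_u ⊗ dx_u = I` as a Young (Riemann–Stieltjes) integral: the sums
`∑ᵢ y(ξᵢ) ⊗ (x(uᵢ₊₁) - x(uᵢ))` over tagged partitions of `[s, t]` converge to `I` as the mesh
tends to zero. -/
def HasYoungIntegral {k : ℕ} (y : ℝ → ⨂[ℝ]^k V) (x : ℝ → V) (s t : ℝ)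
    (I : ⨂[ℝ]^(k + 1) V) : Prop :=
  ∀ ε > 0, ∃ δ > 0, ∀ (n : ℕ) (u ξ : ℕ → ℝ), IsPartition s t n u →
    (∀ i < n, u (i + 1) - u i < δ) → (∀ i < n, ξ i ∈ Set.Icc (u i) (u (i + 1))) →
    ‖∑ i ∈ Finset.range n, snoc V k (y (ξ i)) (x (u (i + 1)) - x (u i)) - I‖ < ε

open Classical in
/-- The value of the Young integral `∫_s^t y_u ⊗ dx_u` (zero if it does not exist). -/
def youngIntegral {k : ℕ} (y : ℝ → ⨂[ℝ]^k V) (x : ℝ → V) (s t : ℝ) : ⨂[ℝ]^(k + 1) V :=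
  if h : ∃ I, HasYoungIntegral y x s t I then h.choose else 0

/-- The iterated integrals `∫_{s < t₁ < ⋯ < tₖ < t} dx_{t₁} ⊗ ⋯ ⊗ dx_{tₖ}`. -/
def iteratedIntegral (x : ℝ → V) (s : ℝ) : ∀ k : ℕ, ℝ → ⨂[ℝ]^k V
  | 0, _ => TensorPower.algebraMap₀ 1
  | k + 1, t => youngIntegral (iteratedIntegral x s k) x s t

/-- The signature `S(x)_{[s,t]}`. -/
def signature (x : ℝ → V) (s t : ℝ) : TSeries V := fun k => iteratedIntegral x s k t

/-- The projective seminorm on a tensor power of a finite-dimensional space is a norm. -/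
theorem tensorPower_eq_zero_of_norm [FiniteDimensional ℝ V] {k : ℕ} (w : ⨂[ℝ]^k V)
    (hw : ‖w‖ = 0) : w = 0 := by
  rw [← Module.forall_dual_apply_eq_zero_iff ℝ]
  intro φ
  let m : MultilinearMap ℝ (fun _ : Fin k => V) ℝ :=
    φ.compMultilinearMap (PiTensorProduct.tprod ℝ)
  let f : ContinuousMultilinearMap ℝ (fun _ : Fin k => V) ℝ :=
    ⟨m, by
      let b := Module.finBasis ℝ V
      have hm : ∀ v, m v = ∑ r : Fin k → Fin (Module.finrank ℝ V),
          (∏ i, b.repr (v i) (r i)) • m fun i => b (r i) := fun v => by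
        conv_lhs => rw [show v = fun i => ∑ j, b.repr (v i) j • b j from
          funext fun i => (b.sum_repr (v i)).symm]
        rw [MultilinearMap.map_sum]
        exact Finset.sum_congr rfl fun r _ => m.map_smul_univ _ _
      change Continuous fun v => m v
      rw [show (fun v => m v) = _ from funext hm]
      refine continuous_finsetSum _ fun r _ => Continuous.fun_smul
        (continuous_finsetProd _ fun i _ => ?_) continuous_const
      exact (LinearMap.continuous_of_finiteDimensional (b.coord (r i))).comp
        (continuous_apply i)⟩
  have h := PiTensorProduct.norm_eval_le_projectiveSeminorm f w
  have e : PiTensorProduct.lift f.toMultilinearMap = φ := by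
    ext v
    simp [f, m]
  rw [hw, mul_zero, e] at h
  exact norm_le_zero_iff.mp h

/-- Young integrals are unique. -/
theorem HasYoungIntegral.unique [FiniteDimensional ℝ V] {k : ℕ} {y : ℝ → ⨂[ℝ]^k V}
    {x : ℝ → V} {s t : ℝ} (hst : s ≤ t) {I J : ⨂[ℝ]^(k + 1) V}
    (hI : HasYoungIntegral y x s t I) (hJ : HasYoungIntegral y x s t J) : I = J := by
  rw [← sub_eq_zero]
  refine tensorPower_eq_zero_of_norm _ (le_antisymm (le_of_forall_pos_lt_add fun ε hε => ?_)
    (norm_nonneg _))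
  obtain ⟨δ₁, hδ₁, h₁⟩ := hI (ε / 2) (half_pos hε)
  obtain ⟨δ₂, hδ₂, h₂⟩ := hJ (ε / 2) (half_pos hε)
  obtain ⟨n, hn⟩ := exists_nat_gt ((t - s) / min δ₁ δ₂)
  have hδ : 0 < min δ₁ δ₂ := lt_min hδ₁ hδ₂
  have hn0 : (0 : ℝ) < n := lt_of_le_of_lt (div_nonneg (sub_nonneg.2 hst) hδ.le) hn
  set u : ℕ → ℝ := fun i => s + i * ((t - s) / n) with hu
  have hq : 0 ≤ (t - s) / n := div_nonneg (sub_nonneg.2 hst) hn0.le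
  have hstep : ∀ i, u (i + 1) - u i = (t - s) / n := fun i => by
    simp only [hu]; push_cast; ring
  have hmesh : (t - s) / n < min δ₁ δ₂ := by
    rw [div_lt_iff₀ hδ] at hn
    rw [div_lt_iff₀ hn0]; linarith
  have hp : IsPartition s t n u := by
    refine ⟨by simp [hu], ?_, fun i _ => by linarith [hstep i]⟩
    simp only [hu]; field_simp; ring
  have ht : ∀ i < n, u i ∈ Set.Icc (u i) (u (i + 1)) := fun i _ =>
    ⟨le_rfl, by linarith [hstep i]⟩
  have a₁ := h₁ n u u hp (fun i _ => by rw [hstep]; exact hmesh.trans_le (min_le_left _ _)) ht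
  have a₂ := h₂ n u u hp (fun i _ => by rw [hstep]; exact hmesh.trans_le (min_le_right _ _)) ht
  set R := ∑ i ∈ Finset.range n, snoc V k (y (u i)) (x (u (i + 1)) - x (u i))
  calc ‖I - J‖ = ‖(R - J) - (R - I)‖ := by congr 1; abel
    _ ≤ ‖R - J‖ + ‖R - I‖ := norm_sub_le _ _
    _ < 0 + ε := by linarith

end Paths

end Sig

end

/-!
The path `x` has increments of order `ω ^ r` for some `r > 1 / 2`, where `ω` is a control: a
superadditive function of intervals which is small on short ones
(`MemCp.exists_control`; the `q`-th power of the `q`-variation serves for any `q` between `p` and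
`2`, its smallness coming from the uniform continuity of `x`). The exponent `2 r > 1` is what makes everything work:
quantities of order `ω ^ (2 r)` on each interval sum to zero in the limit of vanishing mesh
(`IsControl.exists_sum_rpow_le`).

*Existence of the integrals.* If `y` also has increments of order `ω ^ r`, the germ
`Ξ(u, v) = y_u ⊗ (x_v - x_u)` fails to be additive by `(y_v - y_u) ⊗ (x_w - x_v)`, which is of order
`ω ^ (2 r)`. By the sewing lemma (`IsControl.exists_sewing`, resting on the discrete estimate
`IsControl.norm_sub_sum_Ico_le`) its Riemann sums converge to some `I_t`, with
`I_v - I_u = y_u ⊗ (x_v - x_u) + O(ω(u, v) ^ (2 r))`. This expansion shows that `I`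
again has increments of order `ω ^ r`, so the construction can be iterated
(`iteratedIntegral_succ_of_incrLE`).

*The shuffle identity.* A real function is determined, up to a constant, by its first-order
expansion to order `ω ^ (2 r)` (`Expands.sub_eq_sub`). For homogeneous `f · α` and `g · β`, the
product of `⟨f · α, S(x)⟩` and `⟨g · β, S(x)⟩` expands by the product rule (`Expands.mul`), since
the product of two increments is of order `ω ^ (2 r)`. By induction on the degrees, this expansion
is the one of `⟨(f · α) ⧢ (g · β), S(x)⟩` given by the recursive definition of the shuffle product;
both sides vanish at `a`, so they agree (`pairing_incl_mul_pairing_incl`).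
-/

namespace Sig

/-! ### Partitions -/

section Partitions

variable {s t r : ℝ} {n m : ℕ} {u v : ℕ → ℝ}

theorem IsPartition.le_of_le (hu : IsPartition s t n u) {i j : ℕ} (hij : i ≤ j) (hj : j ≤ n) :
    u i ≤ u j := by
  induction j, hij using Nat.le_induction with
  | base => exact le_rfl
  | succ j hij ih => exact (ih (by omega)).trans (hu.2.2 j (by omega))

theorem IsPartition.left_le (hu : IsPartition s t n u) {i : ℕ} (hi : i ≤ n) : s ≤ u i :=
  hu.1 ▸ hu.le_of_le (Nat.zero_le i) hi

theorem IsPartition.le_right (hu : IsPartition s t n u) {i : ℕ} (hi : i ≤ n) : u i ≤ t :=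
  hu.2.1 ▸ hu.le_of_le hi le_rfl

/-- The partition of `[s, t]` into `n ≥ 1` intervals of equal length. -/
noncomputable def uniformPartition (s t : ℝ) (n : ℕ) (i : ℕ) : ℝ := s + i * ((t - s) / n)

theorem uniformPartition_succ_sub (s t : ℝ) (n i : ℕ) :
    uniformPartition s t n (i + 1) - uniformPartition s t n i = (t - s) / n := by
  simp only [uniformPartition]; push_cast; ring

theorem isPartition_uniformPartition (hst : s ≤ t) (hn : n ≠ 0) :
    IsPartition s t n (uniformPartition s t n) := by
  refine ⟨by simp [uniformPartition], ?_, fun i _ => ?_⟩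
  · simp only [uniformPartition]; field_simp; ring
  · have := uniformPartition_succ_sub s t n i
    have : 0 ≤ (t - s) / n := div_nonneg (sub_nonneg.2 hst) n.cast_nonneg
    linarith

theorem eventually_uniformPartition_mesh_lt (s t : ℝ) {δ : ℝ} (hδ : 0 < δ) :
    ∀ᶠ N : ℕ in Filter.atTop, ∀ i < N + 1,
      uniformPartition s t (N + 1) (i + 1) - uniformPartition s t (N + 1) i < δ := by
  have h := (tendsto_const_div_atTop_nhds_zero_nat (t - s)).comp (Filter.tendsto_add_atTop_nat 1)
  filter_upwards [h.eventually_lt_const hδ] with N hN i _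
  rw [uniformPartition_succ_sub]
  exact hN

theorem exists_isPartition_mesh_lt (hst : s ≤ t) {δ : ℝ} (hδ : 0 < δ) :
    ∃ n u, IsPartition s t n u ∧ ∀ i < n, u (i + 1) - u i < δ := by
  obtain ⟨N, hN⟩ := (eventually_uniformPartition_mesh_lt s t hδ).exists
  exact ⟨N + 1, _, isPartition_uniformPartition hst N.succ_ne_zero, hN⟩

theorem IsPartition.exists_concat (hu : IsPartition s t n u) (hv : IsPartition t r m v) :
    ∃ w, IsPartition s r (n + m) w ∧ (∀ i ≤ n, w i = u i) ∧ ∀ j ≤ m, w (n + j) = v j := by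
  have h₁ : ∀ i ≤ n, (if i ≤ n then u i else v (i - n)) = u i := fun i hi => if_pos hi
  have h₂ : ∀ j ≤ m, (if n + j ≤ n then u (n + j) else v (n + j - n)) = v j := by
    intro j _
    rcases Nat.eq_zero_or_pos j with rfl | hj
    · simp [hu.2.1, hv.1]
    · rw [if_neg (by omega), Nat.add_sub_cancel_left]
  refine ⟨fun i => if i ≤ n then u i else v (i - n), ⟨?_, ?_, fun i hi => ?_⟩, h₁, h₂⟩
  · exact (h₁ 0 (Nat.zero_le n)).trans hu.1
  · exact (h₂ m le_rfl).trans hv.2.1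
  · rcases lt_or_ge i n with h | h
    · exact ((h₁ i h.le).trans_le (hu.2.2 i h)).trans_eq (h₁ (i + 1) h).symm
    · obtain ⟨j, rfl⟩ := Nat.exists_eq_add_of_le h
      exact ((h₂ j (by omega)).trans_le (hv.2.2 j (by omega))).trans_eq
        (h₂ (j + 1) (by omega)).symm

theorem sum_concat {A : Type*} [AddCommMonoid A] (F : ℝ → ℝ → A) {w : ℕ → ℝ}
    (h₁ : ∀ i ≤ n, w i = u i) (h₂ : ∀ j ≤ m, w (n + j) = v j) :
    ∑ i ∈ Finset.range (n + m), F (w i) (w (i + 1)) =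
      ∑ i ∈ Finset.range n, F (u i) (u (i + 1)) +
        ∑ i ∈ Finset.range m, F (v i) (v (i + 1)) := by
  rw [Finset.sum_range_add]
  congr 1
  · refine Finset.sum_congr rfl fun i hi => ?_
    have := Finset.mem_range.1 hi
    rw [h₁ i (by omega), h₁ (i + 1) (by omega)]
  · refine Finset.sum_congr rfl fun i hi => ?_
    have := Finset.mem_range.1 hi
    rw [h₂ i (by omega), add_assoc, h₂ (i + 1) (by omega)]

theorem mesh_concat_lt {w : ℕ → ℝ} {δ : ℝ} (h₁ : ∀ i ≤ n, w i = u i)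
    (h₂ : ∀ j ≤ m, w (n + j) = v j) (hu : ∀ i < n, u (i + 1) - u i < δ)
    (hv : ∀ i < m, v (i + 1) - v i < δ) : ∀ i < n + m, w (i + 1) - w i < δ := by
  intro i hi
  rcases lt_or_ge i n with h | h
  · rw [h₁ i h.le, h₁ (i + 1) h]; exact hu i h
  · obtain ⟨j, rfl⟩ := Nat.exists_eq_add_of_le h
    rw [h₂ j (by omega), add_assoc, h₂ (j + 1) (by omega)]; exact hv j (by omega)

/-- The points of a finite subset of `[s, t]`, together with `s` and `t`, in increasing order. -/
theorem exists_strict_partition_of_finset (hst : s ≤ t) (P : Finset ℝ)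
    (hP : ∀ c ∈ P, c ∈ Set.Icc s t) :
    ∃ n v, IsPartition s t n v ∧ (∀ i j, i < j → j ≤ n → v i < v j) ∧
      ∀ c ∈ P, ∃ j ≤ n, v j = c := by
  set Q : Finset ℝ := insert s (insert t P) with hQ
  have hQs : ∀ c ∈ Q, c ∈ Set.Icc s t := by
    intro c hc
    rw [hQ, Finset.mem_insert, Finset.mem_insert] at hc
    rcases hc with rfl | rfl | hc
    · exact ⟨le_rfl, hst⟩
    · exact ⟨hst, le_rfl⟩
    · exact hP c hc
  have hs : s ∈ Q := by simp [hQ]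
  have ht : t ∈ Q := by simp [hQ]
  obtain ⟨n, hn⟩ : ∃ n, Q.card = n + 1 :=
    Nat.exists_eq_succ_of_ne_zero (Finset.card_ne_zero_of_mem hs)
  set e := Q.orderEmbOfFin hn with he
  have hmem : ∀ i, e i ∈ Set.Icc s t := fun i => hQs _ (Q.orderEmbOfFin_mem hn i)
  have hsurj : ∀ c ∈ Q, ∃ i, e i = c := fun c hc => by
    have := Q.range_orderEmbOfFin hn
    exact (Set.ext_iff.1 this c).2 hc
  have hlt : ∀ i j (_ : i < j) (hj : j ≤ n),
      e (⟨min i n, by omega⟩) < e (⟨min j n, by omega⟩) := fun i j hij hj =>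
    e.strictMono (by simp only [Fin.mk_lt_mk]; omega)
  refine ⟨n, fun i => e ⟨min i n, by omega⟩, ⟨?_, ?_, fun i hi => ?_⟩, hlt, ?_⟩
  · obtain ⟨i, hi⟩ := hsurj s hs
    refine le_antisymm ?_ (hmem _).1
    rw [← hi]
    exact e.monotone (by simp)
  · obtain ⟨i, hi⟩ := hsurj t ht
    refine le_antisymm (hmem _).2 ?_
    rw [← hi]
    exact e.monotone (by simp only [Fin.le_def]; omega)
  · exact (hlt i (i + 1) (by omega) hi).le
  · intro c hc
    obtain ⟨i, hi⟩ := hsurj c (by simp [hQ, hc])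
    refine ⟨i, by omega, ?_⟩
    rw [← hi]
    exact congrArg e (Fin.ext (by simp only; omega))

/-- If the points of a partition `u` are among those of a strictly increasing partition `v`, then
`v` consists of blocks `v (σ i), …, v (σ (i + 1))` that partition the intervals of `u`. -/
theorem exists_blocks (hu : IsPartition s t n u) (hv : IsPartition s t m v)
    (hmono : ∀ i j, i < j → j ≤ m → v i < v j) (h : ∀ i ≤ n, ∃ j ≤ m, v j = u i) :
    ∃ σ : ℕ → ℕ, σ 0 = 0 ∧ σ n = m ∧ (∀ i < n, σ i ≤ σ (i + 1)) ∧ (∀ i ≤ n, σ i ≤ m) ∧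
      ∀ i ≤ n, v (σ i) = u i := by
  choose! σ hσ using h
  have hinj : ∀ i j, i ≤ m → j ≤ m → v i = v j → i = j := by
    intro i j hi hj hij
    rcases lt_trichotomy i j with h | h | h
    · exact absurd hij (hmono i j h hj).ne
    · exact h
    · exact absurd hij (hmono j i h hi).ne'
  refine ⟨σ, ?_, ?_, fun i hi => ?_, fun i hi => (hσ i hi).1, fun i hi => (hσ i hi).2⟩
  · exact hinj _ _ (hσ 0 (Nat.zero_le n)).1 (Nat.zero_le m)
      (((hσ 0 (Nat.zero_le n)).2.trans hu.1).trans hv.1.symm)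
  · exact hinj _ _ (hσ n le_rfl).1 le_rfl (((hσ n le_rfl).2.trans hu.2.1).trans hv.2.1.symm)
  · by_contra hlt
    have := hmono _ _ (not_le.1 hlt) (hσ i hi.le).1
    rw [(hσ i hi.le).2, (hσ (i + 1) hi).2] at this
    exact absurd (hu.2.2 i hi) (not_le.2 this)

theorem sum_range_eq_sum_blocks {A : Type*} [AddCommMonoid A] (F : ℕ → A) {σ : ℕ → ℕ}
    (h0 : σ 0 = 0) (hσ : ∀ i < n, σ i ≤ σ (i + 1)) :
    ∑ l ∈ Finset.range (σ n), F l =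
      ∑ i ∈ Finset.range n, ∑ l ∈ Finset.Ico (σ i) (σ (i + 1)), F l := by
  induction n with
  | zero => simp [h0]
  | succ n ih =>
    rw [Finset.sum_range_succ, ← ih fun i hi => hσ i (by omega),
      Finset.sum_range_add_sum_Ico _ (hσ n (by omega))]

end Partitions

/-! ### Controls and the sewing lemma -/

/-- A control on `[a, b]`: a nonnegative superadditive function of subintervals that tends to
zero with their length. -/
structure IsControl (a b : ℝ) (ω : ℝ → ℝ → ℝ) : Prop where
  nonneg : ∀ u v, a ≤ u → u ≤ v → v ≤ b → 0 ≤ ω u v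
  add_le : ∀ u v w, a ≤ u → u ≤ v → v ≤ w → w ≤ b → ω u v + ω v w ≤ ω u w
  small : ∀ ε > 0, ∃ δ > 0, ∀ u v, a ≤ u → u ≤ v → v ≤ b → v - u < δ → ω u v ≤ ε

section Sewing

variable {a b : ℝ} {ω : ℝ → ℝ → ℝ}

theorem IsControl.self_eq_zero (hω : IsControl a b ω) {u : ℝ} (ha : a ≤ u) (hb : u ≤ b) :
    ω u u = 0 := by
  have h₁ := hω.nonneg u u ha le_rfl hb
  have h₂ := hω.add_le u u u ha le_rfl le_rfl hb
  linarith

theorem IsControl.mono (hω : IsControl a b ω) {s u v t : ℝ} (ha : a ≤ s) (hsu : s ≤ u)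
    (huv : u ≤ v) (hvt : v ≤ t) (hb : t ≤ b) : ω u v ≤ ω s t := by
  have h₁ := hω.add_le s u t ha hsu (huv.trans hvt) hb
  have h₂ := hω.add_le u v t (ha.trans hsu) huv hvt hb
  have h₃ := hω.nonneg s u ha hsu (by linarith)
  have h₄ := hω.nonneg v t (by linarith) hvt hb
  linarith

theorem IsControl.sum_le (hω : IsControl a b ω) {s t : ℝ} {n : ℕ} {u : ℕ → ℝ} (ha : a ≤ s)
    (hb : t ≤ b) (hu : IsPartition s t n u) :
    ∑ i ∈ Finset.range n, ω (u i) (u (i + 1)) ≤ ω s t := by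
  have key : ∀ m ≤ n, ∑ i ∈ Finset.range m, ω (u i) (u (i + 1)) ≤ ω s (u m) := by
    intro m
    induction m with
    | zero =>
      intro _
      rw [Finset.sum_range_zero, hu.1]
      exact hω.nonneg _ _ ha le_rfl ((hu.left_le le_rfl).trans (hu.le_right le_rfl) |>.trans hb)
    | succ m ih =>
      intro hm
      rw [Finset.sum_range_succ]
      refine (add_le_add_left (ih (by omega)) _).trans ?_
      exact hω.add_le _ _ _ ha (hu.left_le (by omega)) (hu.2.2 m hm)
        ((hu.le_right hm).trans hb)
  exact (key n le_rfl).trans_eq (by rw [hu.2.1])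

/-- Errors of order `θ > 1` in a control disappear in the limit of Riemann sums. -/
theorem IsControl.exists_sum_rpow_le (hω : IsControl a b ω) {θ : ℝ} (hθ : 1 < θ) (C : ℝ)
    {ε : ℝ} (hε : 0 < ε) :
    ∃ δ > 0, ∀ s t, a ≤ s → s ≤ t → t ≤ b → ∀ (n : ℕ) (u : ℕ → ℝ), IsPartition s t n u →
      (∀ i < n, u (i + 1) - u i < δ) →
      ∑ i ∈ Finset.range n, C * ω (u i) (u (i + 1)) ^ θ ≤ ε := by
  -- `η` is chosen so that `|C| η ^ (θ - 1) ω(a, b) ≤ ε`.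
  set A := (|C| + 1) * (|ω a b| + 1) with hA
  have hA0 : 0 < A := by positivity
  set η := (ε / A) ^ (1 / (θ - 1)) with hη
  have hθ' : 0 < θ - 1 := by linarith
  have hη0 : 0 < η := by positivity
  have hηθ : η ^ (θ - 1) = ε / A := by
    rw [hη, ← Real.rpow_mul (by positivity), one_div, inv_mul_cancel₀ hθ'.ne', Real.rpow_one]
  obtain ⟨δ, hδ, h⟩ := hω.small η hη0
  refine ⟨δ, hδ, fun s t hs hst ht n u hu hmesh => ?_⟩
  have hle : ∀ i ∈ Finset.range n, C * ω (u i) (u (i + 1)) ^ θ ≤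
      (|C| * (ε / A)) * ω (u i) (u (i + 1)) := by
    intro i hi
    have hi := Finset.mem_range.1 hi
    have h1 : a ≤ u i := hs.trans (hu.left_le hi.le)
    have h2 : u (i + 1) ≤ b := (hu.le_right hi).trans ht
    have h0 := hω.nonneg _ _ h1 (hu.2.2 i hi) h2
    have hsm := h _ _ h1 (hu.2.2 i hi) h2 (hmesh i hi)
    have hpow : ω (u i) (u (i + 1)) ^ θ ≤ ε / A * ω (u i) (u (i + 1)) := by
      rw [← hηθ, show θ = (θ - 1) + 1 by ring, Real.rpow_add' h0 (by linarith), Real.rpow_one]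
      simp only [add_sub_cancel_right]
      gcongr
    calc _ ≤ |C| * ω (u i) (u (i + 1)) ^ θ := by
          gcongr
          exact le_abs_self C
      _ ≤ _ := by rw [mul_assoc]; gcongr
  refine (Finset.sum_le_sum hle).trans ?_
  rw [← Finset.mul_sum]
  have h3 := (hω.sum_le hs ht hu).trans (hω.mono le_rfl hs hst ht le_rfl)
  have h4 : |C| * (ε / A) * (∑ i ∈ Finset.range n, ω (u i) (u (i + 1))) ≤
      (|C| + 1) * (ε / A) * (|ω a b| + 1) := by
    refine (mul_le_mul_of_nonneg_left (h3.trans ((le_abs_self _).trans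
      (le_add_of_nonneg_right zero_le_one))) (by positivity)).trans ?_
    gcongr
    exact le_add_of_nonneg_right zero_le_one
  refine h4.trans_eq ?_
  rw [hA]; field_simp

variable {G : Type*} [SeminormedAddCommGroup G]

/-- The discrete sewing estimate. A partition is cut at the interval where half of the control is
used up; the two outer parts carry at most half of it each, and `2 · 2 ^ (-θ) < 1` closes the
induction on the number of intervals. -/
theorem IsControl.norm_sub_sum_Ico_le (hω : IsControl a b ω) {θ K : ℝ} (hθ : 1 < θ) (hK : 0 ≤ K)
    {Ξ : ℝ → ℝ → G} (h0 : ∀ u, Ξ u u = 0)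
    (hΞ : ∀ u v w, a ≤ u → u ≤ v → v ≤ w → w ≤ b →
      ‖Ξ u w - Ξ u v - Ξ v w‖ ≤ K * ω u w ^ θ)
    {s t : ℝ} {n : ℕ} {u : ℕ → ℝ} (ha : a ≤ s) (hb : t ≤ b) (hu : IsPartition s t n u)
    {i j : ℕ} (hij : i ≤ j) (hj : j ≤ n) :
    ‖Ξ (u i) (u j) - ∑ l ∈ Finset.Ico i j, Ξ (u l) (u (l + 1))‖ ≤
      2 / (1 - 2 ^ (1 - θ)) * K * ω (u i) (u j) ^ θ := by
  have h2 : (2 : ℝ) ^ (1 - θ) < 1 := Real.rpow_lt_one_of_one_lt_of_neg (by norm_num) (by linarith)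
  have hua : ∀ l ≤ n, a ≤ u l := fun l hl => ha.trans (hu.left_le hl)
  have hub : ∀ l ≤ n, u l ≤ b := fun l hl => (hu.le_right hl).trans hb
  set C := 2 / (1 - (2 : ℝ) ^ (1 - θ)) with hC
  have hC0 : 0 < C := div_pos two_pos (by linarith)
  have hC2 : 2 + C * 2 ^ (1 - θ) = C := by
    rw [hC]; field_simp [(by linarith : (1 - (2 : ℝ) ^ (1 - θ)) ≠ 0)]; ring
  obtain ⟨d, hd⟩ : ∃ d, j - i = d := ⟨_, rfl⟩
  induction d using Nat.strong_induction_on generalizing i j with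
  | _ d ih =>
  have hW : ∀ k l, k ≤ l → l ≤ n → 0 ≤ ω (u k) (u l) := fun k l hkl hl =>
    hω.nonneg _ _ (hua k (by omega)) (hu.le_of_le hkl hl) (hub l hl)
  rcases hij.eq_or_lt with rfl | hlt
  · simp only [h0, Finset.Ico_self, Finset.sum_empty, sub_zero, norm_zero]
    have := hW i i le_rfl hj
    positivity
  set W := ω (u i) (u j) with hWdef
  have hW0 : 0 ≤ W := hW i j hij hj
  -- `m` is the least index for which the interval from `u m` to `u (m + 1)` ends the partition or
  -- brings the control from `u i` above `W / 2`.
  obtain ⟨m, him, hmj, hm₁, hm₂⟩ : ∃ m, i ≤ m ∧ m < j ∧ ω (u i) (u m) ≤ W / 2 ∧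
      ω (u (m + 1)) (u j) ≤ W / 2 := by
    have hex : ∃ m, i ≤ m ∧ (m + 1 = j ∨ W / 2 < ω (u i) (u (m + 1))) :=
      ⟨j - 1, by omega, Or.inl (by omega)⟩
    classical
    set m := Nat.find hex with hmdef
    obtain ⟨him, hm⟩ := Nat.find_spec hex
    have hmj : m < j := lt_of_le_of_lt (Nat.find_min' hex ⟨by omega, Or.inl (by omega)⟩ :
      m ≤ j - 1) (by omega)
    refine ⟨m, him, hmj, ?_, ?_⟩
    · rcases him.eq_or_lt with h | h
      · rw [← hmdef] at h
        rw [← h, hω.self_eq_zero (hua i (by omega)) (hub i (by omega))]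
        positivity
      · have := Nat.find_min hex (m := m - 1) (by omega)
        rw [← hmdef] at h
        rw [not_and, not_or, Nat.sub_add_cancel (by omega)] at this
        exact not_lt.1 (this (by omega)).2
    · rw [← hmdef] at hm him
      rcases hm with h | h
      · rw [h, hω.self_eq_zero (hua j hj) (hub j hj)]
        positivity
      · have := hω.add_le (u i) (u (m + 1)) (u j) (hua i (by omega))
          (hu.le_of_le (by omega) (by omega)) (hu.le_of_le (by omega) hj) (hub j hj)
        linarith
  have e₁ := ih (m - i) (by omega) him (by omega) rfl
  have e₂ := ih (j - (m + 1)) (by omega) (i := m + 1) (by omega) hj rfl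
  have e₃ := hΞ (u i) (u m) (u j) (hua _ (by omega)) (hu.le_of_le him (by omega))
    (hu.le_of_le hmj.le hj) (hub j hj)
  have e₄ := hΞ (u m) (u (m + 1)) (u j) (hua _ (by omega)) (hu.le_of_le (by omega) (by omega))
    (hu.le_of_le hmj hj) (hub j hj)
  have hmW : ω (u m) (u j) ≤ W := hω.mono (hua i (by omega)) (hu.le_of_le him (by omega))
    (hu.le_of_le hmj.le hj) le_rfl (hub j hj)
  have hmW0 := hW m j hmj.le hj
  have hsum : ∑ l ∈ Finset.Ico i j, Ξ (u l) (u (l + 1)) =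
      ∑ l ∈ Finset.Ico i m, Ξ (u l) (u (l + 1)) + Ξ (u m) (u (m + 1)) +
        ∑ l ∈ Finset.Ico (m + 1) j, Ξ (u l) (u (l + 1)) := by
    rw [← Finset.sum_Ico_succ_top him, Finset.sum_Ico_consecutive _ (by omega) hmj]
  have hhalf : (W / 2) ^ θ = 2 ^ (1 - θ) / 2 * W ^ θ := by
    rw [Real.div_rpow hW0 two_pos.le, Real.rpow_sub two_pos, Real.rpow_one]
    field_simp
  have hθ0 : 0 ≤ θ := by linarith
  calc ‖Ξ (u i) (u j) - ∑ l ∈ Finset.Ico i j, Ξ (u l) (u (l + 1))‖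
      = ‖(Ξ (u i) (u j) - Ξ (u i) (u m) - Ξ (u m) (u j)) +
          (Ξ (u m) (u j) - Ξ (u m) (u (m + 1)) - Ξ (u (m + 1)) (u j)) +
          (Ξ (u i) (u m) - ∑ l ∈ Finset.Ico i m, Ξ (u l) (u (l + 1))) +
          (Ξ (u (m + 1)) (u j) - ∑ l ∈ Finset.Ico (m + 1) j, Ξ (u l) (u (l + 1)))‖ := by
        rw [hsum]; congr 1; abel
    _ ≤ K * W ^ θ + K * ω (u m) (u j) ^ θ + C * K * ω (u i) (u m) ^ θ +
          C * K * ω (u (m + 1)) (u j) ^ θ := by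
        refine (norm_add_le _ _).trans (add_le_add ((norm_add_le _ _).trans
          (add_le_add ((norm_add_le _ _).trans (add_le_add e₃ e₄)) e₁)) e₂)
    _ ≤ K * W ^ θ + K * W ^ θ + C * K * (W / 2) ^ θ + C * K * (W / 2) ^ θ := by
        have := hW i m him (by omega)
        have := hW (m + 1) j hmj hj
        gcongr
    _ = (2 + C * 2 ^ (1 - θ)) * K * W ^ θ := by rw [hhalf]; ring
    _ = C * K * W ^ θ := by rw [hC2]

theorem IsControl.norm_sub_sum_le (hω : IsControl a b ω) {θ K : ℝ} (hθ : 1 < θ) (hK : 0 ≤ K)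
    {Ξ : ℝ → ℝ → G} (h0 : ∀ u, Ξ u u = 0)
    (hΞ : ∀ u v w, a ≤ u → u ≤ v → v ≤ w → w ≤ b →
      ‖Ξ u w - Ξ u v - Ξ v w‖ ≤ K * ω u w ^ θ)
    {s t : ℝ} {n : ℕ} {u : ℕ → ℝ} (ha : a ≤ s) (hb : t ≤ b) (hu : IsPartition s t n u) :
    ‖Ξ s t - ∑ l ∈ Finset.range n, Ξ (u l) (u (l + 1))‖ ≤
      2 / (1 - 2 ^ (1 - θ)) * K * ω s t ^ θ := by
  have := hω.norm_sub_sum_Ico_le hθ hK h0 hΞ ha hb hu (Nat.zero_le n) le_rfl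
  rwa [hu.1, hu.2.1, ← Finset.range_eq_Ico] at this

/-- Refining a partition changes the Riemann sum by at most the sum of the sewing errors of its
intervals. -/
theorem IsControl.norm_sum_sub_sum_le (hω : IsControl a b ω) {θ K : ℝ} (hθ : 1 < θ) (hK : 0 ≤ K)
    {Ξ : ℝ → ℝ → G} (h0 : ∀ u, Ξ u u = 0)
    (hΞ : ∀ u v w, a ≤ u → u ≤ v → v ≤ w → w ≤ b →
      ‖Ξ u w - Ξ u v - Ξ v w‖ ≤ K * ω u w ^ θ)
    {s t : ℝ} {n m : ℕ} {u v : ℕ → ℝ} (ha : a ≤ s) (hb : t ≤ b) (hu : IsPartition s t n u)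
    (hv : IsPartition s t m v) (hmono : ∀ i j, i < j → j ≤ m → v i < v j)
    (h : ∀ i ≤ n, ∃ j ≤ m, v j = u i) :
    ‖∑ i ∈ Finset.range n, Ξ (u i) (u (i + 1)) - ∑ l ∈ Finset.range m, Ξ (v l) (v (l + 1))‖ ≤
      ∑ i ∈ Finset.range n, 2 / (1 - 2 ^ (1 - θ)) * K * ω (u i) (u (i + 1)) ^ θ := by
  obtain ⟨σ, hσ0, hσn, hσ, hσm, hσu⟩ := exists_blocks hu hv hmono h
  rw [← hσn, sum_range_eq_sum_blocks _ hσ0 hσ, ← Finset.sum_sub_distrib]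
  refine (norm_sum_le _ _).trans (Finset.sum_le_sum fun i hi => ?_)
  have hi := Finset.mem_range.1 hi
  have := hω.norm_sub_sum_Ico_le hθ hK h0 hΞ ha hb hv (hσ i hi) (hσm (i + 1) hi)
  rwa [hσu i hi.le, hσu (i + 1) hi] at this

/-- The sewing lemma: the Riemann sums of an almost additive germ `Ξ` converge, uniformly in the
end point, to a function whose increments are approximated by `Ξ`. -/
theorem IsControl.exists_sewing [CompleteSpace G] (hω : IsControl a b ω) {θ K : ℝ} (hθ : 1 < θ)
    (hK : 0 ≤ K) {Ξ : ℝ → ℝ → G} (h0 : ∀ u, Ξ u u = 0)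
    (hΞ : ∀ u v w, a ≤ u → u ≤ v → v ≤ w → w ≤ b →
      ‖Ξ u w - Ξ u v - Ξ v w‖ ≤ K * ω u w ^ θ) :
    ∃ I : ℝ → G,
      (∀ ε > 0, ∃ δ > 0, ∀ t, a ≤ t → t ≤ b → ∀ (n : ℕ) (u : ℕ → ℝ), IsPartition a t n u →
        (∀ i < n, u (i + 1) - u i < δ) →
        ‖∑ i ∈ Finset.range n, Ξ (u i) (u (i + 1)) - I t‖ ≤ ε) ∧
      ∀ u v, a ≤ u → u ≤ v → v ≤ b →
        ‖I v - I u - Ξ u v‖ ≤ 2 / (1 - 2 ^ (1 - θ)) * K * ω u v ^ θ := by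
  set C := 2 / (1 - (2 : ℝ) ^ (1 - θ)) * K with hC
  have hcauchy : ∀ ε > 0, ∃ δ > 0, ∀ t, a ≤ t → t ≤ b → ∀ (n : ℕ) (u : ℕ → ℝ),
      IsPartition a t n u → (∀ i < n, u (i + 1) - u i < δ) → ∀ (m : ℕ) (v : ℕ → ℝ),
      IsPartition a t m v → (∀ i < m, v (i + 1) - v i < δ) →
      ‖∑ i ∈ Finset.range n, Ξ (u i) (u (i + 1)) -
        ∑ i ∈ Finset.range m, Ξ (v i) (v (i + 1))‖ ≤ ε := by
    intro ε hε
    obtain ⟨δ, hδ, h⟩ := hω.exists_sum_rpow_le hθ C (half_pos hε)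
    refine ⟨δ, hδ, fun t hat htb n u hu hum m v hv hvm => ?_⟩
    -- Both partitions are compared with their common refinement `w`.
    obtain ⟨N, w, hw, hmono, hP⟩ := exists_strict_partition_of_finset hat
      ((Finset.range (n + 1)).image u ∪ (Finset.range (m + 1)).image v) (by
        intro c hc
        simp only [Finset.mem_union, Finset.mem_image, Finset.mem_range] at hc
        rcases hc with ⟨i, hi, rfl⟩ | ⟨i, hi, rfl⟩
        · exact ⟨hu.left_le (by omega), hu.le_right (by omega)⟩
        · exact ⟨hv.left_le (by omega), hv.le_right (by omega)⟩)
    have e₁ := (hω.norm_sum_sub_sum_le hθ hK h0 hΞ le_rfl htb hu hw hmono fun i hi =>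
      hP _ (Finset.mem_union_left _ (Finset.mem_image_of_mem _
        (Finset.mem_range.2 (by omega))))).trans (h a t le_rfl hat htb n u hu hum)
    have e₂ := (hω.norm_sum_sub_sum_le hθ hK h0 hΞ le_rfl htb hv hw hmono fun i hi =>
      hP _ (Finset.mem_union_right _ (Finset.mem_image_of_mem _
        (Finset.mem_range.2 (by omega))))).trans (h a t le_rfl hat htb m v hv hvm)
    rw [norm_sub_rev] at e₂
    refine (norm_sub_le_norm_sub_add_norm_sub _ (∑ l ∈ Finset.range N, Ξ (w l) (w (l + 1))) _).trans
      ?_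
    linarith
  -- `I t` is the limit along uniform partitions; `hcauchy` extends the convergence to all others.
  have hlim : ∀ t, ∃ J : G, a ≤ t → t ≤ b → Filter.Tendsto (fun N : ℕ =>
      ∑ i ∈ Finset.range (N + 1), Ξ (uniformPartition a t (N + 1) i)
        (uniformPartition a t (N + 1) (i + 1))) Filter.atTop (nhds J) := by
    intro t
    by_cases ht : a ≤ t ∧ t ≤ b
    · obtain ⟨hat, htb⟩ := ht
      refine (cauchySeq_tendsto_of_complete (Metric.cauchySeq_iff'.2 fun ε hε => ?_)).imp
        fun J hJ _ _ => hJ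
      obtain ⟨δ, hδ, h⟩ := hcauchy (ε / 2) (half_pos hε)
      obtain ⟨N₀, hN₀⟩ := Filter.eventually_atTop.1 (eventually_uniformPartition_mesh_lt a t hδ)
      refine ⟨N₀, fun N hN => ?_⟩
      rw [dist_eq_norm]
      exact (h t hat htb _ _ (isPartition_uniformPartition hat N.succ_ne_zero) (hN₀ N hN) _ _
        (isPartition_uniformPartition hat N₀.succ_ne_zero) (hN₀ N₀ le_rfl)).trans_lt
        (half_lt_self hε)
    · exact ⟨0, fun h₁ h₂ => absurd ⟨h₁, h₂⟩ ht⟩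
  choose I hI using hlim
  have hconv : ∀ ε > 0, ∃ δ > 0, ∀ t, a ≤ t → t ≤ b → ∀ (n : ℕ) (u : ℕ → ℝ),
      IsPartition a t n u → (∀ i < n, u (i + 1) - u i < δ) →
      ‖∑ i ∈ Finset.range n, Ξ (u i) (u (i + 1)) - I t‖ ≤ ε := by
    intro ε hε
    obtain ⟨δ, hδ, h⟩ := hcauchy ε hε
    refine ⟨δ, hδ, fun t hat htb n u hu hum => ?_⟩
    refine le_of_tendsto ((hI t hat htb).const_sub _).norm ?_
    filter_upwards [eventually_uniformPartition_mesh_lt a t hδ] with N hN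
    exact h t hat htb n u hu hum _ _ (isPartition_uniformPartition hat N.succ_ne_zero) hN
  -- `I v - I u` is approximated by the sum over `q` for a partition of `[a, v]` that concatenates
  -- a partition `p` of `[a, u]` with a partition `q` of `[u, v]`.
  refine ⟨I, hconv, fun u v hau huv hvb => le_of_forall_pos_le_add fun ε hε => ?_⟩
  obtain ⟨δ, hδ, h⟩ := hconv (ε / 2) (half_pos hε)
  obtain ⟨n, p, hp, hpm⟩ := exists_isPartition_mesh_lt hau hδ
  obtain ⟨m, q, hq, hqm⟩ := exists_isPartition_mesh_lt huv hδ
  obtain ⟨w, hw, h₁, h₂⟩ := hp.exists_concat hq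
  have e₁ := h u hau (huv.trans hvb) n p hp hpm
  have e₂ := h v (hau.trans huv) hvb _ w hw (mesh_concat_lt h₁ h₂ hpm hqm)
  have e₃ := hω.norm_sub_sum_le hθ hK h0 hΞ hau hvb hq
  rw [sum_concat Ξ h₁ h₂] at e₂
  set P := ∑ i ∈ Finset.range n, Ξ (p i) (p (i + 1))
  set Q := ∑ i ∈ Finset.range m, Ξ (q i) (q (i + 1))
  calc ‖I v - I u - Ξ u v‖ = ‖(P - I u) - (P + Q - I v) - (Ξ u v - Q)‖ := by congr 1; abel
    _ ≤ ε / 2 + ε / 2 + C * ω u v ^ θ :=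
      (norm_sub_le _ _).trans (add_le_add ((norm_sub_le _ _).trans (add_le_add e₁ e₂)) e₃)
    _ = C * ω u v ^ θ + ε := by ring

end Sewing

/-! ### The control of a path of finite `p`-variation -/

section Variation

variable {V : Type*} [NormedAddCommGroup V]

/-- The `q`-th power of the `q`-variation of `x` on `[s, t]`. -/
noncomputable def powVariation (q : ℝ) (x : ℝ → V) (s t : ℝ) : ℝ≥0∞ :=
  ⨆ (n : ℕ) (u : ℕ → ℝ) (_ : IsPartition s t n u),
    ∑ i ∈ Finset.range n, ‖x (u (i + 1)) - x (u i)‖ₑ ^ q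

theorem sum_le_powVariation (q : ℝ) (x : ℝ → V) {s t : ℝ} {n : ℕ} {u : ℕ → ℝ}
    (hu : IsPartition s t n u) :
    ∑ i ∈ Finset.range n, ‖x (u (i + 1)) - x (u i)‖ₑ ^ q ≤ powVariation q x s t :=
  le_iSup_of_le n (le_iSup_of_le u (le_iSup_of_le hu le_rfl))

theorem powVariation_le {q : ℝ} {x : ℝ → V} {s t : ℝ} {c : ℝ≥0∞}
    (h : ∀ n u, IsPartition s t n u →
      ∑ i ∈ Finset.range n, ‖x (u (i + 1)) - x (u i)‖ₑ ^ q ≤ c) : powVariation q x s t ≤ c :=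
  iSup_le fun n => iSup_le fun u => iSup_le fun hu => h n u hu

theorem rpow_enorm_le_powVariation (q : ℝ) (x : ℝ → V) {s t : ℝ} (hst : s ≤ t) :
    ‖x t - x s‖ₑ ^ q ≤ powVariation q x s t := by
  have hu : IsPartition s t 1 (uniformPartition s t 1) :=
    isPartition_uniformPartition hst one_ne_zero
  have := sum_le_powVariation q x hu
  rwa [Finset.sum_range_one, zero_add, hu.1, hu.2.1] at this

theorem powVariation_add_le (q : ℝ) (x : ℝ → V) {s t r : ℝ} (hst : s ≤ t) (htr : t ≤ r) :
    powVariation q x s t + powVariation q x t r ≤ powVariation q x s r := by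
  have hn : ∀ {s t : ℝ}, s ≤ t → Nonempty {c : ℕ × (ℕ → ℝ) // IsPartition s t c.1 c.2} :=
    fun h => ⟨⟨(1, _), isPartition_uniformPartition h one_ne_zero⟩⟩
  have he : ∀ s t : ℝ, powVariation q x s t =
      ⨆ c : {c : ℕ × (ℕ → ℝ) // IsPartition s t c.1 c.2},
        ∑ i ∈ Finset.range c.1.1, ‖x (c.1.2 (i + 1)) - x (c.1.2 i)‖ₑ ^ q := fun s t => by
    rw [powVariation, iSup_subtype, iSup_prod]
  have := hn hst
  have := hn htr
  rw [he s t, he t r]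
  refine ENNReal.iSup_add_iSup_le fun ⟨⟨n, u⟩, hu⟩ ⟨⟨m, v⟩, hv⟩ => ?_
  obtain ⟨w, hw, h₁, h₂⟩ := hu.exists_concat hv
  have := sum_le_powVariation q x hw
  rwa [sum_concat (fun c d => ‖x d - x c‖ₑ ^ q) h₁ h₂] at this

theorem powVariation_mono (q : ℝ) (x : ℝ → V) {s u v t : ℝ} (hsu : s ≤ u) (huv : u ≤ v)
    (hvt : v ≤ t) : powVariation q x u v ≤ powVariation q x s t :=
  (le_add_self.trans (powVariation_add_le q x hsu huv)).trans
    (le_self_add.trans (powVariation_add_le q x (hsu.trans huv) hvt))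

/-- Interpolation: the increments of `x` being bounded by `η`, the `q`-variation is bounded in
terms of the `p`-variation for `p ≤ q`. -/
theorem powVariation_le_mul {p q : ℝ} (hp : 0 ≤ p) (hpq : p ≤ q) {x : ℝ → V} {s t : ℝ}
    {η : ℝ≥0∞} (h : ∀ u v, s ≤ u → u ≤ v → v ≤ t → ‖x v - x u‖ₑ ≤ η) :
    powVariation q x s t ≤ η ^ (q - p) * powVariation p x s t := by
  refine powVariation_le fun n u hu => ?_
  refine le_trans ?_ (mul_le_mul_right (sum_le_powVariation p x hu) _)
  rw [Finset.mul_sum]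
  refine Finset.sum_le_sum fun i hi => ?_
  have hi := Finset.mem_range.1 hi
  rw [← sub_add_cancel q p, ENNReal.rpow_add_of_nonneg _ _ (sub_nonneg.2 hpq) hp,
    sub_add_cancel]
  exact mul_le_mul_left (ENNReal.rpow_le_rpow (h _ _ (hu.left_le hi.le) (hu.2.2 i hi)
    (hu.le_right hi)) (sub_nonneg.2 hpq)) _

/-- For `p < q < 2` the `q`-th power of the `q`-variation is a control: uniform
continuity makes it small on short intervals, by interpolation with the `p`-variation on `[a, b]`,
of which only finiteness is needed. -/
theorem MemCp.exists_control [NormedSpace ℝ V] {p a b : ℝ} {x : ℝ → V} (hp₁ : 1 ≤ p) (hp₂ : p < 2)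
    (hx : MemCp p a b x) :
    ∃ (ω : ℝ → ℝ → ℝ) (r : ℝ), 1 / 2 < r ∧ IsControl a b ω ∧
      ∀ u v, a ≤ u → u ≤ v → v ≤ b → ‖x v - x u‖ ≤ ω u v ^ r := by
  obtain ⟨q, hpq, hq2⟩ := exists_between hp₂
  have hp0 : 0 < p := by linarith
  have hq0 : 0 < q := by linarith
  have hfin : powVariation p x a b < ∞ :=
    (ENNReal.rpow_lt_top_iff_of_pos (one_div_pos.2 hp0)).1 hx.2
  have hη : ∀ {u v η}, a ≤ u → v ≤ b →
      (∀ u' v', u ≤ u' → u' ≤ v' → v' ≤ v → ‖x v' - x u'‖ₑ ≤ η) → u ≤ v →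
      powVariation q x u v ≤ η ^ (q - p) * powVariation p x a b := fun ha hb h huv =>
    (powVariation_le_mul hp0.le hpq.le h).trans
      (mul_le_mul_right (powVariation_mono p x ha huv hb) _)
  have hqfin : ∀ {u v}, a ≤ u → u ≤ v → v ≤ b → powVariation q x u v < ∞ := by
    intro u v ha huv hb
    -- Increments are bounded by the `p`-variation.
    refine (hη (η := powVariation p x a b ^ (1 / p)) ha hb (fun u' v' h₁ h₂ h₃ => ?_)
      huv).trans_lt (ENNReal.mul_lt_top (ENNReal.rpow_lt_top_of_nonneg (by linarith)
        (ENNReal.rpow_lt_top_of_nonneg (by positivity) hfin.ne).ne) hfin)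
    rw [one_div, ENNReal.le_rpow_inv_iff hp0]
    exact (rpow_enorm_le_powVariation p x h₂).trans
      (powVariation_mono p x (ha.trans h₁) h₂ (h₃.trans hb))
  refine ⟨fun u v => (powVariation q x u v).toReal, 1 / q,
    one_div_lt_one_div_of_lt hq0 hq2, ⟨fun _ _ _ _ _ => ENNReal.toReal_nonneg, ?_, ?_⟩, ?_⟩
  · intro u v w ha huv hvw hb
    rw [← ENNReal.toReal_add (hqfin ha huv (hvw.trans hb)).ne
      (hqfin (ha.trans huv) hvw hb).ne]
    exact ENNReal.toReal_mono (hqfin ha (huv.trans hvw) hb).ne (powVariation_add_le q x huv hvw)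
  · intro ε hε
    -- `η` solves `η ^ (q - p) (A + 1) = ε`, where `A` is the `p`-th power of the `p`-variation.
    set A := (powVariation p x a b).toReal with hA
    have hA0 : 0 ≤ A := ENNReal.toReal_nonneg
    have hqp : 0 < q - p := by linarith
    set η := (ε / (A + 1)) ^ (1 / (q - p)) with hηdef
    have hη0 : 0 < η := by positivity
    have hηq : η ^ (q - p) = ε / (A + 1) := by
      rw [hηdef, ← Real.rpow_mul (by positivity), one_div, inv_mul_cancel₀ hqp.ne', Real.rpow_one]
    obtain ⟨δ, hδ, h⟩ := Metric.uniformContinuousOn_iff.1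
      (isCompact_Icc.uniformContinuousOn_of_continuous hx.1) η hη0
    refine ⟨δ, hδ, fun u v ha huv hb huvδ => ?_⟩
    have := hη (η := ENNReal.ofReal η) ha hb (fun u' v' h₁ h₂ h₃ => by
      rw [← ofReal_norm, ← dist_eq_norm]
      refine ENNReal.ofReal_le_ofReal (h _ ⟨by linarith, by linarith⟩ _
        ⟨by linarith, by linarith⟩ ?_).le
      rw [Real.dist_eq, abs_of_nonneg (by linarith)]
      linarith) huv
    rw [ENNReal.ofReal_rpow_of_pos hη0, ← ENNReal.ofReal_toReal hfin.ne, ← hA,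
      ← ENNReal.ofReal_mul (by positivity), hηq] at this
    refine (ENNReal.toReal_le_of_le_ofReal (by positivity) this).trans ?_
    rw [div_mul_eq_mul_div, div_le_iff₀ (by positivity)]
    nlinarith
  · intro u v ha huv hb
    have := ENNReal.toReal_mono (hqfin ha huv hb).ne (rpow_enorm_le_powVariation q x huv)
    rw [← ENNReal.toReal_rpow, toReal_enorm] at this
    rw [one_div, Real.le_rpow_inv_iff_of_pos (norm_nonneg _) ENNReal.toReal_nonneg hq0]
    exact this

end Variation

/-! ### Young integrals -/

section Young

variable {a b : ℝ} {ω : ℝ → ℝ → ℝ} {r : ℝ}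
  {E F G : Type*} [SeminormedAddCommGroup E] [SeminormedAddCommGroup F]
  [SeminormedAddCommGroup G]

/-- The increments of `y` over subintervals of `[a, b]` are `O(ω ^ r)`. -/
def IncrLE (a b : ℝ) (ω : ℝ → ℝ → ℝ) (r : ℝ) (y : ℝ → E) : Prop :=
  ∃ C, 0 ≤ C ∧ ∀ u v, a ≤ u → u ≤ v → v ≤ b → ‖y v - y u‖ ≤ C * ω u v ^ r

theorem IncrLE.exists_norm_le (hω : IsControl a b ω) (hr : 0 ≤ r) {y : ℝ → E}
    (hy : IncrLE a b ω r y) : ∃ M, 0 ≤ M ∧ ∀ u, a ≤ u → u ≤ b → ‖y u‖ ≤ M := by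
  obtain ⟨C, hC, h⟩ := hy
  refine ⟨‖y a‖ + C * |ω a b| ^ r, by positivity, fun u ha hb => ?_⟩
  have h₁ := h a u le_rfl ha hb
  have h₂ : ω a u ^ r ≤ |ω a b| ^ r := Real.rpow_le_rpow (hω.nonneg _ _ le_rfl ha hb)
    ((hω.mono le_rfl le_rfl ha hb le_rfl).trans (le_abs_self _)) hr
  have h₃ := mul_le_mul_of_nonneg_left h₂ hC
  have := norm_le_norm_add_norm_sub' (y u) (y a)
  linarith

theorem IsControl.rpow_mul_rpow_le (hω : IsControl a b ω) (hr : 0 < r) {s u v w z t : ℝ}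
    (ha : a ≤ s) (hsu : s ≤ u) (huv : u ≤ v) (hvt : v ≤ t) (hsw : s ≤ w) (hwz : w ≤ z)
    (hzt : z ≤ t) (hb : t ≤ b) : ω u v ^ r * ω w z ^ r ≤ ω s t ^ (2 * r) := by
  have h₁ := hω.nonneg u v (by linarith) huv (by linarith)
  have h₂ := hω.nonneg w z (by linarith) hwz (by linarith)
  have h₃ := hω.nonneg s t ha (by linarith) hb
  rw [two_mul, Real.rpow_add' h₃ (by linarith)]
  have h₄ := hω.mono ha hsu huv hvt hb
  have h₅ := hω.mono ha hsw hwz hzt hb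
  gcongr

variable [NormedSpace ℝ E] [NormedSpace ℝ F] [NormedSpace ℝ G]

theorem IncrLE.exists_norm_apply_le (hω : IsControl a b ω) (hr : 0 < r) {y : ℝ → E} {x : ℝ → F}
    (hy : IncrLE a b ω r y) (hx : IncrLE a b ω r x) (B : E →ₗ[ℝ] F →ₗ[ℝ] G) {M : ℝ}
    (hM : 0 ≤ M) (hB : ∀ e f, ‖B e f‖ ≤ M * ‖e‖ * ‖f‖) :
    ∃ K, 0 ≤ K ∧ ∀ s u v w z t, a ≤ s → s ≤ u → u ≤ v → v ≤ t → s ≤ w → w ≤ z → z ≤ t → t ≤ b →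
      ‖B (y v - y u) (x z - x w)‖ ≤ K * ω s t ^ (2 * r) := by
  obtain ⟨C, hC, hy⟩ := hy
  obtain ⟨D, hD, hx⟩ := hx
  refine ⟨M * C * D, by positivity, fun s u v w z t h₁ h₂ h₃ h₄ h₅ h₆ h₇ h₈ => ?_⟩
  have e₁ := hy u v (by linarith) h₃ (by linarith)
  have e₂ := hx w z (by linarith) h₆ (by linarith)
  have e₃ := hω.rpow_mul_rpow_le hr h₁ h₂ h₃ h₄ h₅ h₆ h₇ h₈
  have e₄ : 0 ≤ ω u v := hω.nonneg _ _ (by linarith) h₃ (by linarith)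
  calc _ ≤ M * ‖y v - y u‖ * ‖x z - x w‖ := hB _ _
    _ ≤ M * (C * ω u v ^ r) * (D * ω w z ^ r) := by gcongr
    _ = M * C * D * (ω u v ^ r * ω w z ^ r) := by ring
    _ ≤ _ := by gcongr

/-- Existence of the Young integral `∫ B(y, dx)`, together with the local expansion
`∫_u^v B(y, dx) = B(y_u, x_v - x_u) + O(ω(u, v) ^ (2r))`. Replacing left end points by other tags
costs `O(ω ^ (2r))` on each interval, which is negligible. -/
theorem IncrLE.exists_young [CompleteSpace G] (hω : IsControl a b ω) (hr : 1 / 2 < r)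
    {y : ℝ → E} {x : ℝ → F} (hy : IncrLE a b ω r y) (hx : IncrLE a b ω r x)
    (B : E →ₗ[ℝ] F →ₗ[ℝ] G) {M : ℝ} (hM : 0 ≤ M) (hB : ∀ e f, ‖B e f‖ ≤ M * ‖e‖ * ‖f‖) :
    ∃ I : ℝ → G,
      (∀ t ∈ Set.Icc a b, ∀ ε > 0, ∃ δ > 0, ∀ (n : ℕ) (u ξ : ℕ → ℝ), IsPartition a t n u →
        (∀ i < n, u (i + 1) - u i < δ) → (∀ i < n, ξ i ∈ Set.Icc (u i) (u (i + 1))) →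
        ‖∑ i ∈ Finset.range n, B (y (ξ i)) (x (u (i + 1)) - x (u i)) - I t‖ < ε) ∧
      ∃ C, 0 ≤ C ∧ ∀ u v, a ≤ u → u ≤ v → v ≤ b →
        ‖I v - I u - B (y u) (x v - x u)‖ ≤ C * ω u v ^ (2 * r) := by
  obtain ⟨K, hK, hK'⟩ := hy.exists_norm_apply_le hω (by linarith) hx B hM hB
  have hθ : 1 < 2 * r := by linarith
  obtain ⟨I, hI, hI'⟩ := hω.exists_sewing hθ hK (Ξ := fun u v => B (y u) (x v - x u))
    (fun u => by simp) (fun u v w ha huv hvw hb => by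
      have : B (y u) (x w - x u) - B (y u) (x v - x u) - B (y v) (x w - x v) =
          -B (y v - y u) (x w - x v) := by
        simp only [map_sub, LinearMap.sub_apply]; abel
      rw [this, norm_neg]
      exact hK' u u v v w w ha le_rfl huv hvw huv hvw le_rfl hb)
  have h2 : (2 : ℝ) ^ (1 - 2 * r) < 1 :=
    Real.rpow_lt_one_of_one_lt_of_neg (by norm_num) (by linarith)
  refine ⟨I, fun t ht ε hε => ?_, _, mul_nonneg (div_nonneg two_pos.le (by linarith)) hK, hI'⟩
  obtain ⟨δ₁, hδ₁, h₁⟩ := hI (ε / 3) (by positivity)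
  obtain ⟨δ₂, hδ₂, h₂⟩ := hω.exists_sum_rpow_le hθ K (ε := ε / 3) (by positivity)
  refine ⟨min δ₁ δ₂, lt_min hδ₁ hδ₂, fun n u ξ hu hm hξ => ?_⟩
  have e₁ := h₁ t ht.1 ht.2 n u hu fun i hi => (hm i hi).trans_le (min_le_left _ _)
  have e₂ := h₂ a t le_rfl ht.1 ht.2 n u hu fun i hi => (hm i hi).trans_le (min_le_right _ _)
  have e₃ : ‖∑ i ∈ Finset.range n, B (y (ξ i)) (x (u (i + 1)) - x (u i)) -
      ∑ i ∈ Finset.range n, B (y (u i)) (x (u (i + 1)) - x (u i))‖ ≤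
      ∑ i ∈ Finset.range n, K * ω (u i) (u (i + 1)) ^ (2 * r) := by
    rw [← Finset.sum_sub_distrib]
    refine (norm_sum_le _ _).trans (Finset.sum_le_sum fun i hi => ?_)
    have hi := Finset.mem_range.1 hi
    rw [← LinearMap.sub_apply, ← map_sub]
    exact hK' _ _ _ _ _ _ (hu.left_le hi.le) le_rfl (hξ i hi).1 (hξ i hi).2 le_rfl
      (hu.2.2 i hi) le_rfl ((hu.le_right hi).trans ht.2)
  have := norm_sub_le_norm_sub_add_norm_sub
    (∑ i ∈ Finset.range n, B (y (ξ i)) (x (u (i + 1)) - x (u i)))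
    (∑ i ∈ Finset.range n, B (y (u i)) (x (u (i + 1)) - x (u i))) (I t)
  linarith

/-- A path with the local expansion of a Young integral against `x` is as regular as `x`. -/
theorem IncrLE.of_expansion (hω : IsControl a b ω) (hr : 0 < r)
    {y : ℝ → E} {x : ℝ → F} {I : ℝ → G} (hy : IncrLE a b ω r y) (hx : IncrLE a b ω r x)
    (B : E →ₗ[ℝ] F →ₗ[ℝ] G) {M : ℝ} (hM : 0 ≤ M) (hB : ∀ e f, ‖B e f‖ ≤ M * ‖e‖ * ‖f‖)
    {C : ℝ} (hC : 0 ≤ C) (hI : ∀ u v, a ≤ u → u ≤ v → v ≤ b →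
        ‖I v - I u - B (y u) (x v - x u)‖ ≤ C * ω u v ^ (2 * r)) : IncrLE a b ω r I := by
  obtain ⟨N, hN, hyN⟩ := hy.exists_norm_le hω hr.le
  obtain ⟨D, hD, hx⟩ := hx
  refine ⟨C * |ω a b| ^ r + M * N * D, by positivity, fun u v ha huv hb => ?_⟩
  have e₀ := hω.nonneg u v ha huv hb
  have e₁ := hI u v ha huv hb
  have e₂ : ‖B (y u) (x v - x u)‖ ≤ M * N * (D * ω u v ^ r) := by
    refine (hB _ _).trans ?_
    have := hyN u ha (huv.trans hb)
    have := hx u v ha huv hb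
    gcongr
  have e₃ : ω u v ^ (2 * r) ≤ |ω a b| ^ r * ω u v ^ r := by
    rw [two_mul, Real.rpow_add' e₀ (by linarith)]
    have := (hω.mono le_rfl ha huv hb le_rfl).trans (le_abs_self _)
    gcongr
  have e₄ := mul_le_mul_of_nonneg_left e₃ hC
  have := norm_le_norm_sub_add (I v - I u) (B (y u) (x v - x u))
  linarith

end Young

/-! ### Iterated integrals -/

section Iterated

variable {V : Type*} [NormedAddCommGroup V] [NormedSpace ℝ V]

/-- In finite dimension the projective seminorm on a tensor power is a norm. Recording this as a
Hausdorff property keeps the seminormed structure as the only one in play. -/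
theorem t2Space_tensorPower [FiniteDimensional ℝ V] (k : ℕ) : T2Space (⨂[ℝ]^k V) := by
  let : NormedAddCommGroup (⨂[ℝ]^k V) :=
    NormedAddCommGroup.ofSeparation tensorPower_eq_zero_of_norm
  infer_instance

theorem completeSpace_tensorPower [FiniteDimensional ℝ V] (k : ℕ) :
    CompleteSpace (⨂[ℝ]^k V) := by
  have := t2Space_tensorPower (V := V) k
  exact FiniteDimensional.complete ℝ (⨂[ℝ]^k V)

theorem exists_norm_apply_le_mul {E F : Type*} [SeminormedAddCommGroup E] [NormedSpace ℝ E]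
    [FiniteDimensional ℝ E] [T2Space E] [SeminormedAddCommGroup F] [NormedSpace ℝ F]
    (φ : E →ₗ[ℝ] F) : ∃ M, 0 ≤ M ∧ ∀ e, ‖φ e‖ ≤ M * ‖e‖ :=
  ⟨‖LinearMap.toContinuousLinearMap φ‖, norm_nonneg _,
    fun e => (LinearMap.toContinuousLinearMap φ).le_opNorm e⟩

theorem exists_norm_apply_apply_le_mul {E F G : Type*} [SeminormedAddCommGroup E]
    [NormedSpace ℝ E] [FiniteDimensional ℝ E] [T2Space E] [SeminormedAddCommGroup F]
    [NormedSpace ℝ F] [FiniteDimensional ℝ F] [T2Space F] [SeminormedAddCommGroup G]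
    [NormedSpace ℝ G] (B : E →ₗ[ℝ] F →ₗ[ℝ] G) :
    ∃ M, 0 ≤ M ∧ ∀ e f, ‖B e f‖ ≤ M * ‖e‖ * ‖f‖ := by
  obtain ⟨M, hM, h⟩ :=
    exists_norm_apply_le_mul (LinearMap.toContinuousLinearMap.toLinearMap ∘ₗ B)
  refine ⟨M, hM, fun e f => ?_⟩
  exact ((LinearMap.toContinuousLinearMap (B e)).le_opNorm f).trans
    (mul_le_mul_of_nonneg_right (h e) (norm_nonneg f))

theorem exists_norm_snoc_le [FiniteDimensional ℝ V] (k : ℕ) :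
    ∃ M, 0 ≤ M ∧ ∀ (w : ⨂[ℝ]^k V) (v : V), ‖snoc V k w v‖ ≤ M * ‖w‖ * ‖v‖ := by
  have := t2Space_tensorPower (V := V) k
  exact exists_norm_apply_apply_le_mul (snoc V k)

theorem exists_abs_le_norm [FiniteDimensional ℝ V] {k : ℕ} (φ : (⨂[ℝ]^k V) →ₗ[ℝ] ℝ) :
    ∃ M, 0 ≤ M ∧ ∀ w, |φ w| ≤ M * ‖w‖ := by
  have := t2Space_tensorPower (V := V) k
  exact exists_norm_apply_le_mul φ

theorem hasYoungIntegral_self {k : ℕ} (y : ℝ → ⨂[ℝ]^k V) (x : ℝ → V) (s : ℝ) :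
    HasYoungIntegral y x s s 0 := by
  refine fun ε hε => ⟨1, one_pos, fun n u ξ hu _ _ => ?_⟩
  rw [Finset.sum_eq_zero, sub_zero, norm_zero]
  · exact hε
  · intro i hi
    have hi := Finset.mem_range.1 hi
    rw [le_antisymm (hu.le_right hi.le) (hu.left_le hi.le),
      le_antisymm (hu.le_right hi) (hu.left_le hi), sub_self, map_zero]

theorem HasYoungIntegral.youngIntegral_eq [FiniteDimensional ℝ V] {k : ℕ} {y : ℝ → ⨂[ℝ]^k V}
    {x : ℝ → V} {s t : ℝ} (hst : s ≤ t) {I : ⨂[ℝ]^(k + 1) V} (h : HasYoungIntegral y x s t I) :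
    youngIntegral y x s t = I := by
  have hex : ∃ I, HasYoungIntegral y x s t I := ⟨I, h⟩
  rw [youngIntegral, dif_pos hex]
  exact hex.choose_spec.unique hst h

theorem iteratedIntegral_succ_self [FiniteDimensional ℝ V] (x : ℝ → V) (a : ℝ) (k : ℕ) :
    iteratedIntegral x a (k + 1) a = 0 :=
  (hasYoungIntegral_self _ x a).youngIntegral_eq le_rfl

variable {a b r : ℝ} {ω : ℝ → ℝ → ℝ}

/-- The step of the recursion: the next iterated integral exists, has a first-order expansion, and
is as regular as the previous one, so that the step can be repeated. -/
theorem iteratedIntegral_succ_of_incrLE [FiniteDimensional ℝ V] {x : ℝ → V}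
    (hω : IsControl a b ω) (hr : 1 / 2 < r) (hx : IncrLE a b ω r x) (k : ℕ)
    (hk : IncrLE a b ω r (iteratedIntegral x a k)) :
    (∀ t ∈ Set.Icc a b, HasYoungIntegral (iteratedIntegral x a k) x a t
      (iteratedIntegral x a (k + 1) t)) ∧
    (∃ C, 0 ≤ C ∧ ∀ u v, a ≤ u → u ≤ v → v ≤ b →
      ‖iteratedIntegral x a (k + 1) v - iteratedIntegral x a (k + 1) u -
        snoc V k (iteratedIntegral x a k u) (x v - x u)‖ ≤ C * ω u v ^ (2 * r)) ∧
    IncrLE a b ω r (iteratedIntegral x a (k + 1)) := by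
  have := completeSpace_tensorPower (V := V) (k + 1)
  obtain ⟨M, hM, hB⟩ := exists_norm_snoc_le (V := V) k
  obtain ⟨I, hI, C, hC, hexp⟩ := hk.exists_young hω hr hx (snoc V k) hM hB
  have hIeq : ∀ t, a ≤ t → t ≤ b → iteratedIntegral x a (k + 1) t = I t := fun t ha hb =>
    HasYoungIntegral.youngIntegral_eq ha (hI t ⟨ha, hb⟩)
  have hexp' : ∀ u v, a ≤ u → u ≤ v → v ≤ b →
      ‖iteratedIntegral x a (k + 1) v - iteratedIntegral x a (k + 1) u -
        snoc V k (iteratedIntegral x a k u) (x v - x u)‖ ≤ C * ω u v ^ (2 * r) := by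
    intro u v ha huv hb
    rw [hIeq u ha (huv.trans hb), hIeq v (ha.trans huv) hb]
    exact hexp u v ha huv hb
  refine ⟨fun t ht => ?_, ⟨C, hC, hexp'⟩,
    hk.of_expansion hω (by linarith) hx (snoc V k) hM hB hC hexp'⟩
  rw [hIeq t ht.1 ht.2]
  exact hI t ht

theorem incrLE_iteratedIntegral [FiniteDimensional ℝ V] {x : ℝ → V}
    (hω : IsControl a b ω) (hr : 1 / 2 < r) (hx : IncrLE a b ω r x) (k : ℕ) :
    IncrLE a b ω r (iteratedIntegral x a k) := by
  induction k with
  | zero =>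
    refine ⟨0, le_rfl, fun u v _ _ _ => ?_⟩
    simp [iteratedIntegral]
  | succ k ih => exact (iteratedIntegral_succ_of_incrLE hω hr hx k ih).2.2

end Iterated

/-! ### The pairing -/

section Pairing

theorem incl_mul_inclVec {M : Type*} [AddCommGroup M] [Module ℝ M] (k : ℕ) (f : ⨂[ℝ]^k M)
    (α : M) : incl M k f * inclVec M α = incl M (k + 1) (snoc M k f α) := by
  simp [inclVec, DirectSum.lof_eq_of, DirectSum.of_mul_of, snoc, snocEquiv, TensorPower.gMul_def]

variable {V : Type*} [AddCommGroup V] [Module ℝ V]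

theorem snoc_tprod {M : Type*} [AddCommGroup M] [Module ℝ M] (k : ℕ) (m : Fin k → M) (a : M) :
    snoc M k (PiTensorProduct.tprod ℝ m) a =
      PiTensorProduct.tprod ℝ (Fin.append m fun _ : Fin 1 => a) := by
  rw [← TensorPower.tprod_mul_tprod, TensorPower.gMul_def]
  simp [snoc, snocEquiv]

theorem pairingDual_snoc_snoc (k : ℕ) (f : ⨂[ℝ]^k (Module.Dual ℝ V)) (α : Module.Dual ℝ V)
    (w : ⨂[ℝ]^k V) (v : V) :
    TensorPower.pairingDual ℝ V (k + 1) (snoc (Module.Dual ℝ V) k f α) (snoc V k w v) =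
      TensorPower.pairingDual ℝ V k f w * α v := by
  induction f using PiTensorProduct.induction_on with
  | add f₁ f₂ h₁ h₂ => simp only [map_add, LinearMap.add_apply, h₁, h₂, add_mul]
  | smul_tprod c φ =>
    induction w using PiTensorProduct.induction_on with
    | add w₁ w₂ h₁ h₂ => simp only [map_add, LinearMap.add_apply, h₁, h₂, add_mul]
    | smul_tprod d m =>
      simp only [map_smul, LinearMap.smul_apply, snoc_tprod, smul_eq_mul,
        TensorPower.pairingDual_tprod_tprod]
      rw [Fin.prod_univ_add]
      simp [Fin.append_left, Fin.append_right]
      ring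

theorem pairing_incl (k : ℕ) (f : ⨂[ℝ]^k (Module.Dual ℝ V)) (s : TSeries V) :
    pairing V (incl _ k f) s = TensorPower.pairingDual ℝ V k f (s k) := by
  simp [pairing]

theorem pairing_add (f g : TAlg (Module.Dual ℝ V)) (s : TSeries V) :
    pairing V (f + g) s = pairing V f s + pairing V g s := map_add _ f g

theorem pairing_smul (c : ℝ) (f : TAlg (Module.Dual ℝ V)) (s : TSeries V) :
    pairing V (c • f) s = c * pairing V f s := map_smul _ c f

theorem pairing_zero (s : TSeries V) : pairing V 0 s = 0 := map_zero _

theorem pairingDual_algebraMap₀ (c d : ℝ) :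
    TensorPower.pairingDual ℝ V 0 (TensorPower.algebraMap₀ c) (TensorPower.algebraMap₀ d) =
      c * d := by
  simp [TensorPower.algebraMap₀, PiTensorProduct.isEmptyEquiv_symm_apply, mul_comm]

/-- Tensors of positive degree are sums of products `w · a` with `a` of degree one. -/
theorem snoc_induction {M : Type*} [AddCommGroup M] [Module ℝ M] (k : ℕ)
    {P : (⨂[ℝ]^(k + 1) M) → Prop} (h0 : P 0) (hadd : ∀ f g, P f → P g → P (f + g))
    (h : ∀ f α, P (snoc M k f α)) (f : ⨂[ℝ]^(k + 1) M) : P f := by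
  obtain ⟨f, rfl⟩ := (snocEquiv M k).surjective f
  induction f using TensorProduct.induction_on with
  | zero => rw [map_zero]; exact h0
  | add f g hf hg => rw [map_add]; exact hadd _ _ hf hg
  | tmul f α => exact h f α

theorem shuffle_incl_incl {M : Type*} [AddCommGroup M] [Module ℝ M] (k l : ℕ)
    (f : ⨂[ℝ]^k M) (g : ⨂[ℝ]^l M) :
    shuffle M (incl M k f) (incl M l g) = shuffleHom M k l f g := by
  simp [shuffle]

theorem pairing_incl_algebraMap₀_signature {V : Type*} [NormedAddCommGroup V] [NormedSpace ℝ V]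
    (x : ℝ → V) (a t c : ℝ) :
    pairing V (incl _ 0 (TensorPower.algebraMap₀ c)) (signature x a t) = c := by
  rw [pairing_incl, signature, iteratedIntegral, pairingDual_algebraMap₀, mul_one]

end Pairing

/-! ### First-order expansions -/

section Expansion

variable {a b θ : ℝ} {ω : ℝ → ℝ → ℝ}

/-- `F v - F u = D u v + O(ω(u, v) ^ θ)` on subintervals of `[a, b]`. For `θ > 1` this says that
`F` is the integral of the germ `D`. -/
def Expands (a b : ℝ) (ω : ℝ → ℝ → ℝ) (θ : ℝ) (F : ℝ → ℝ) (D : ℝ → ℝ → ℝ) : Prop :=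
  ∃ C, 0 ≤ C ∧ ∀ u v, a ≤ u → u ≤ v → v ≤ b → |F v - F u - D u v| ≤ C * ω u v ^ θ

theorem Expands.add {F F' : ℝ → ℝ} {D D' : ℝ → ℝ → ℝ} (h : Expands a b ω θ F D)
    (h' : Expands a b ω θ F' D') :
    Expands a b ω θ (fun t => F t + F' t) fun u v => D u v + D' u v := by
  obtain ⟨C, hC, h⟩ := h
  obtain ⟨C', hC', h'⟩ := h'
  refine ⟨C + C', by positivity, fun u v ha huv hb => ?_⟩
  rw [show F v + F' v - (F u + F' u) - (D u v + D' u v) =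
    (F v - F u - D u v) + (F' v - F' u - D' u v) by ring, add_mul]
  exact (abs_add_le _ _).trans (add_le_add (h u v ha huv hb) (h' u v ha huv hb))

theorem Expands.congr_germ {F : ℝ → ℝ} {D D' : ℝ → ℝ → ℝ} (h : Expands a b ω θ F D)
    (hD : ∀ u ∈ Set.Icc a b, ∀ v, D u v = D' u v) : Expands a b ω θ F D' := by
  obtain ⟨C, hC, h⟩ := h
  exact ⟨C, hC, fun u v ha huv hb => hD u ⟨ha, huv.trans hb⟩ v ▸ h u v ha huv hb⟩

/-- The product rule: the product of two increments is itself `O(ω ^ (2r))`. -/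
theorem Expands.mul {r : ℝ} (hω : IsControl a b ω) (hr : 0 < r) {F G : ℝ → ℝ}
    {D D' : ℝ → ℝ → ℝ} (hF : IncrLE a b ω r F) (hG : IncrLE a b ω r G)
    (hFD : Expands a b ω (2 * r) F D) (hGD : Expands a b ω (2 * r) G D') :
    Expands a b ω (2 * r) (fun t => F t * G t) fun u v => G u * D u v + F u * D' u v := by
  obtain ⟨M, hM, hFM⟩ := hF.exists_norm_le hω hr.le
  obtain ⟨N, hN, hGN⟩ := hG.exists_norm_le hω hr.le
  obtain ⟨A, hA, hF⟩ := hF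
  obtain ⟨B, hB, hG⟩ := hG
  obtain ⟨C, hC, hFD⟩ := hFD
  obtain ⟨C', hC', hGD⟩ := hGD
  refine ⟨N * C + M * C' + A * B, by positivity, fun u v ha huv hb => ?_⟩
  simp only [Real.norm_eq_abs] at hFM hGN hF hG
  have e₁ : |G u * (F v - F u - D u v)| ≤ N * (C * ω u v ^ (2 * r)) := by
    rw [abs_mul]
    exact mul_le_mul (hGN u ha (huv.trans hb)) (hFD u v ha huv hb) (abs_nonneg _) hN
  have e₂ : |F u * (G v - G u - D' u v)| ≤ M * (C' * ω u v ^ (2 * r)) := by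
    rw [abs_mul]
    exact mul_le_mul (hFM u ha (huv.trans hb)) (hGD u v ha huv hb) (abs_nonneg _) hM
  have e₃ : |(F v - F u) * (G v - G u)| ≤ A * B * ω u v ^ (2 * r) := by
    have h₀ := hω.nonneg u v ha huv hb
    rw [abs_mul, two_mul, Real.rpow_add' h₀ (by linarith), mul_mul_mul_comm]
    exact mul_le_mul (hF u v ha huv hb) (hG u v ha huv hb) (abs_nonneg _) (by positivity)
  rw [show F v * G v - F u * G u - (G u * D u v + F u * D' u v) =
    G u * (F v - F u - D u v) + F u * (G v - G u - D' u v) + (F v - F u) * (G v - G u) by ring]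
  refine ((abs_add_le _ _).trans (add_le_add ((abs_add_le _ _).trans (add_le_add e₁ e₂))
    e₃)).trans_eq ?_
  ring

/-- A function is determined, up to a constant, by its expansion to an order `θ > 1`. -/
theorem Expands.sub_eq_sub (hω : IsControl a b ω) (hθ : 1 < θ) {F H : ℝ → ℝ} {D : ℝ → ℝ → ℝ}
    (hF : Expands a b ω θ F D) (hH : Expands a b ω θ H D) {t : ℝ} (ht : t ∈ Set.Icc a b) :
    F t - F a = H t - H a := by
  obtain ⟨C, hC, hF⟩ := hF
  obtain ⟨C', hC', hH⟩ := hH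
  rw [← sub_eq_zero, ← abs_nonpos_iff]
  refine le_of_forall_pos_le_add fun ε hε => ?_
  rw [zero_add]
  obtain ⟨δ, hδ, h⟩ := hω.exists_sum_rpow_le hθ (C + C') hε
  obtain ⟨n, u, hu, hm⟩ := exists_isPartition_mesh_lt ht.1 hδ
  refine le_trans ?_ (h a t le_rfl ht.1 ht.2 n u hu hm)
  have e : F t - F a - (H t - H a) = ∑ i ∈ Finset.range n,
      ((F (u (i + 1)) - H (u (i + 1))) - (F (u i) - H (u i))) := by
    rw [Finset.sum_range_sub (fun i => F (u i) - H (u i)), hu.1, hu.2.1]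
    ring
  rw [e]
  refine (Finset.abs_sum_le_sum_abs _ _).trans (Finset.sum_le_sum fun i hi => ?_)
  have hi := Finset.mem_range.1 hi
  have h₁ := hu.left_le hi.le
  have h₂ := (hu.le_right hi).trans ht.2
  rw [show F (u (i + 1)) - H (u (i + 1)) - (F (u i) - H (u i)) =
    (F (u (i + 1)) - F (u i) - D (u i) (u (i + 1))) -
      (H (u (i + 1)) - H (u i) - D (u i) (u (i + 1))) by ring, add_mul]
  exact (abs_sub _ _).trans (add_le_add (hF _ _ h₁ (hu.2.2 i hi) h₂) (hH _ _ h₁ (hu.2.2 i hi) h₂))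

end Expansion

/-! ### The shuffle identity -/

section Shuffle

variable {V : Type*} [NormedAddCommGroup V] [NormedSpace ℝ V] [FiniteDimensional ℝ V]
  {a b r : ℝ} {ω : ℝ → ℝ → ℝ} {x : ℝ → V}

theorem incrLE_pairing_incl (hω : IsControl a b ω) (hr : 1 / 2 < r) (hx : IncrLE a b ω r x)
    (k : ℕ) (f : ⨂[ℝ]^k (Module.Dual ℝ V)) :
    IncrLE a b ω r fun t => pairing V (incl _ k f) (signature x a t) := by
  obtain ⟨C, hC, h⟩ := incrLE_iteratedIntegral hω hr hx k
  obtain ⟨M, hM, hf⟩ := exists_abs_le_norm (TensorPower.pairingDual ℝ V k f)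
  refine ⟨M * C, by positivity, fun u v ha huv hb => ?_⟩
  simp only [pairing_incl, signature, ← map_sub, Real.norm_eq_abs, mul_assoc]
  exact (hf _).trans (mul_le_mul_of_nonneg_left (h u v ha huv hb) hM)

/-- In integral notation, `d⟨w · α, S(x)⟩ = ⟨w, S(x)⟩ dα(x)`. -/
theorem expands_pairing_mul_inclVec (hω : IsControl a b ω) (hr : 1 / 2 < r)
    (hx : IncrLE a b ω r x) (w : TAlg (Module.Dual ℝ V)) (α : Module.Dual ℝ V) :
    Expands a b ω (2 * r) (fun t => pairing V (w * inclVec _ α) (signature x a t))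
      fun u v => pairing V w (signature x a u) * α (x v - x u) := by
  induction w using DirectSum.induction_on with
  | zero => exact ⟨0, le_rfl, fun u v _ _ _ => by simp [pairing_zero]⟩
  | add w₁ w₂ h₁ h₂ =>
    simp only [add_mul, pairing_add]
    exact h₁.add h₂
  | of k f =>
    obtain ⟨C, hC, h⟩ := (iteratedIntegral_succ_of_incrLE hω hr hx k
      (incrLE_iteratedIntegral hω hr hx k)).2.1
    obtain ⟨M, hM, hf⟩ := exists_abs_le_norm
      (TensorPower.pairingDual ℝ V (k + 1) (snoc _ k f α))
    refine ⟨M * C, by positivity, fun u v ha huv hb => ?_⟩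
    rw [← DirectSum.lof_eq_of ℝ, incl_mul_inclVec]
    simp only [pairing_incl, signature]
    rw [← pairingDual_snoc_snoc, ← map_sub, ← map_sub, mul_assoc]
    exact (hf _).trans (mul_le_mul_of_nonneg_left (h u v ha huv hb) hM)

theorem pairing_mul_inclVec_signature_self (x : ℝ → V) (a : ℝ) (w : TAlg (Module.Dual ℝ V))
    (α : Module.Dual ℝ V) : pairing V (w * inclVec _ α) (signature x a a) = 0 := by
  induction w using DirectSum.induction_on with
  | zero => rw [zero_mul, pairing_zero]
  | add w₁ w₂ h₁ h₂ => rw [add_mul, pairing_add, h₁, h₂, add_zero]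
  | of k f =>
    rw [← DirectSum.lof_eq_of ℝ, incl_mul_inclVec, pairing_incl, signature,
      iteratedIntegral_succ_self, map_zero]

/-- The shuffle identity for homogeneous tensors, at all end points `t` simultaneously. By
induction both sides have the same expansion. -/
theorem pairing_incl_mul_pairing_incl (hω : IsControl a b ω) (hr : 1 / 2 < r)
    (hx : IncrLE a b ω r x) : ∀ (k l : ℕ) (f : ⨂[ℝ]^k (Module.Dual ℝ V))
      (g : ⨂[ℝ]^l (Module.Dual ℝ V)), ∀ t ∈ Set.Icc a b,
      pairing V (incl _ k f) (signature x a t) * pairing V (incl _ l g) (signature x a t) =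
        pairing V (shuffleHom _ k l f g) (signature x a t)
  | 0, l, f, g, t, _ => by
    obtain ⟨c, rfl⟩ := TensorPower.algebraMap₀.surjective f
    rw [shuffleHom_zero_left, pairing_smul, pairing_incl_algebraMap₀_signature]
  | k + 1, 0, f, g, t, _ => by
    obtain ⟨c, rfl⟩ := TensorPower.algebraMap₀.surjective g
    rw [shuffleHom_zero_right, pairing_smul, pairing_incl_algebraMap₀_signature, mul_comm]
  | k + 1, l + 1, f, g, t, ht => by
    induction f using snoc_induction with
    | h0 => simp only [map_zero, LinearMap.zero_apply, pairing_zero, zero_mul]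
    | hadd f₁ f₂ h₁ h₂ => simp only [map_add, LinearMap.add_apply, pairing_add, add_mul, h₁, h₂]
    | h f α =>
    induction g using snoc_induction with
    | h0 => simp only [map_zero, pairing_zero, mul_zero]
    | hadd g₁ g₂ h₁ h₂ => simp only [map_add, pairing_add, mul_add, h₁, h₂]
    | h g β =>
    -- By `ih₁` and `ih₂` the germs of the two sides, `⟨g · β, S⟩ ⟨f, S⟩ dα + ⟨f · α, S⟩ ⟨g, S⟩ dβ`
    -- and `⟨f ⧢ (g · β), S⟩ dα + ⟨(f · α) ⧢ g, S⟩ dβ`, agree.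
    have ih₁ := pairing_incl_mul_pairing_incl hω hr hx k (l + 1) f (snoc _ l g β)
    have ih₂ := pairing_incl_mul_pairing_incl hω hr hx (k + 1) l (snoc _ k f α) g
    have hf := expands_pairing_mul_inclVec hω hr hx (incl _ k f) α
    have hg := expands_pairing_mul_inclVec hω hr hx (incl _ l g) β
    simp only [incl_mul_inclVec] at hf hg
    have hprod := hf.mul hω (by linarith) (incrLE_pairing_incl hω hr hx _ _)
      (incrLE_pairing_incl hω hr hx _ _) hg
    have hsh := (expands_pairing_mul_inclVec hω hr hx
      (shuffleHom _ k (l + 1) f (snoc _ l g β)) α).add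
      (expands_pairing_mul_inclVec hω hr hx (shuffleHom _ (k + 1) l (snoc _ k f α) g) β)
    have hD := hprod.congr_germ (D' := fun u v =>
      pairing V (shuffleHom _ k (l + 1) f (snoc _ l g β)) (signature x a u) * α (x v - x u) +
        pairing V (shuffleHom _ (k + 1) l (snoc _ k f α) g) (signature x a u) * β (x v - x u))
      fun u hu v => by rw [← ih₁ u hu, ← ih₂ u hu]; ring
    have := hD.sub_eq_sub hω (by linarith) hsh ht
    simpa only [shuffleHom_snoc_snoc, pairing_add, ← incl_mul_inclVec,
      pairing_mul_inclVec_signature_self, mul_zero, add_zero, sub_zero] using this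
  termination_by k l => k + l

theorem pairing_mul_pairing (hω : IsControl a b ω) (hr : 1 / 2 < r) (hx : IncrLE a b ω r x)
    (f g : TAlg (Module.Dual ℝ V)) {t : ℝ} (ht : t ∈ Set.Icc a b) :
    pairing V f (signature x a t) * pairing V g (signature x a t) =
      pairing V (shuffle _ f g) (signature x a t) := by
  induction f using DirectSum.induction_on with
  | zero => simp only [map_zero, LinearMap.zero_apply, pairing_zero, zero_mul]
  | add f₁ f₂ h₁ h₂ => simp only [map_add, LinearMap.add_apply, pairing_add, add_mul, h₁, h₂]
  | of k f =>
  induction g using DirectSum.induction_on with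
  | zero => simp only [map_zero, pairing_zero, mul_zero]
  | add g₁ g₂ h₁ h₂ => simp only [map_add, pairing_add, mul_add, h₁, h₂]
  | of l g =>
    rw [← DirectSum.lof_eq_of ℝ, ← DirectSum.lof_eq_of ℝ, shuffle_incl_incl]
    exact pairing_incl_mul_pairing_incl hω hr hx k l f g t ht

end Shuffle

end Sig

theorem mainTheorem2 {V : Type*} [NormedAddCommGroup V] [NormedSpace ℝ V]
    [FiniteDimensional ℝ V] (p : ℝ) (hp₁ : 1 ≤ p) (hp₂ : p < 2) (a b : ℝ) (hab : a ≤ b)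
    (x : ℝ → V) (hx : Sig.MemCp p a b x) :
    (∀ k : ℕ, ∀ t ∈ Set.Icc a b,
      Sig.HasYoungIntegral (Sig.iteratedIntegral x a k) x a t
        (Sig.iteratedIntegral x a (k + 1) t)) ∧
    ∀ f g : Sig.TAlg (Module.Dual ℝ V),
      Sig.pairing V f (Sig.signature x a b) * Sig.pairing V g (Sig.signature x a b) =
        Sig.pairing V (Sig.shuffle (Module.Dual ℝ V) f g) (Sig.signature x a b) := by
  obtain ⟨ω, r, hr, hω, hxω⟩ := hx.exists_control hp₁ hp₂
  have hx' : Sig.IncrLE a b ω r x := ⟨1, zero_le_one, by simpa only [one_mul] using hxω⟩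
  exact ⟨fun k => (Sig.iteratedIntegral_succ_of_incrLE hω hr hx' k
    (Sig.incrLE_iteratedIntegral hω hr hx' k)).1,
    fun f g => Sig.pairing_mul_pairing hω hr hx' f g ⟨hab, le_rfl⟩⟩
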